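/- For $k\ge 0$ let $e_k(x)=\pi^{-1/2}\mathcal L_k^0(|x|^2)$, $x\in\mathbb R^2$, where $\mathcal L^0_k(z)=\frac{e^{z/2}}{k!}\frac{d^k}{dz^k}(z^ke^{-z})$; these are the radial eigenfunctions of $-\Delta+|x|^2$, with eigenvalues $4k+2$. Let $(g_k)_{k\ge0}$ be independent normalized complex Gaussians (density $\frac1\pi e^{-|z|^2}$ on $\mathbb C$) on a probability space $(\Omega,\Sigma,\mathbb P)$ such that for every $\omega$ the series $$f(\omega)=\sum_{k=0}^\infty \frac{g_k(\omega)}{\sqrt{4k+2}}\,e_k$$ converges in $\mathcal S'(\mathbb R^2)$, and let $\mu=\mathbb P\circ f^{-1}$, a probability measure on $\mathcal S'(\mathbb R^2)$ (with the $\sigma$-algebra generated by the evaluations $u\mapsto\langle u,\varphi\rangle$, $\varphi\in\mathcal S(\mathbb R^2)$). For $u\in\mathcal S'(\mathbb R^2)$ put $u_n^\circ=\sum_{j=0}^n\langle u,e_j\rangle e_j$, and let $\alpha_n=\sum_{j=0}^n\frac1{4j+2}$. Fix $1<p<3$. A cutoff is a continuous, compactly supported function $\chi:\mathbb R\to\mathbb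 R$ that equals $1$ on a neighborhood of $0$. For a cutoff $\chi$ let $$\rho_{2^k}(u)=\chi\big(\|u_{2^k}^\circ\|_{L^2}^2-\alpha_{2^k}\big)\exp\Big(\frac{2}{p+1}\|u_{2^k}^\circ\|_{L^{p+1}}^{p+1}\Big),\qquad d\nu_{2^k}=\rho_{2^k}\,d\mu .$$ (1) For every cutoff $\chi$ there is a function $\rho$ on $\mathcal S'(\mathbb R^2)$ such that, for all $1\le r<\infty$, the functions $\rho_{2^k}$ $(k\ge 0)$ and $\rho$ belong to $L^r(\mu)$ and $\rho_{2^k}\to\rho$ in $L^r(\mu)$ as $k\to\infty$. The (signed) measure $d\nu=\rho\,d\mu$ is finite and absolutely continuous with respect to $\mu$, and the total variation of $\nu_{2^k}-\nu$ tends to $0$ as $k\to\infty$. If $\chi\ge0$, then $\rho\ge 0$ $\mu$-almost everywhere, and $\nu$ is a finite nonnegative measure. (2) There is a sequence of nonnegative cutoffs $\chi_{(m)}$, $m\in\mathbb N$, such that, if $\rho_{(m)}$ denotes the limit in (1) for $\chi=\chi_{(m)}$, the union over $m$ of the sets $\{\rho_{(m)}\ne0\}$ has full $\mu$-measure in $\mathcal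 S'(\mathbb R^2)$. -/

import Mathlib

open MeasureTheory ProbabilityTheory Filter Topology SchwartzMap
open scoped ENNReal

noncomputable section

namespace RadialNLS

/-- The plane `ℝ²` with its Euclidean norm. -/
abbrev Plane : Type := EuclideanSpace ℝ (Fin 2)

/-! ### Laguerre functions and the radial eigenfunctions of `-Δ + |x|²` -/

/-- The Laguerre function `𝓛ₖ⁰(z) = (e^{z/2} / k!) (d/dz)^k (z^k e^{-z})`. -/
def laguerreFun (k : ℕ) (z : ℝ) : ℝ :=
  Real.exp (z / 2) / (k.factorial : ℝ) *
    iteratedDeriv k (fun y : ℝ => y ^ k * Real.exp (-y)) z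

/-- The radial eigenfunction `eₖ(x) = π^{-1/2} 𝓛ₖ⁰(|x|²)`, with eigenvalue `4k + 2`. -/
def eigenfun (k : ℕ) (x : Plane) : ℝ :=
  1 / Real.sqrt Real.pi * laguerreFun k (‖x‖ ^ 2)

theorem exists_poly_iteratedDeriv (k : ℕ) : ∀ P : Polynomial ℝ, ∃ Q : Polynomial ℝ,
    iteratedDeriv k (fun y : ℝ => P.eval y * Real.exp (-y)) =
      fun y => Q.eval y * Real.exp (-y) := by
  induction k with
  | zero => intro P; exact ⟨P, by simp⟩
  | succ k ih =>
    intro P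
    obtain ⟨Q, hQ⟩ := ih (Polynomial.derivative P - P)
    refine ⟨Q, ?_⟩
    rw [iteratedDeriv_succ', ← hQ]
    congr 1
    funext y
    have h1 := P.hasDerivAt y
    have h2 : HasDerivAt (fun y : ℝ => Real.exp (-y)) (Real.exp (-y) * (-1)) y :=
      (hasDerivAt_neg y).exp
    have h3 : HasDerivAt (fun y : ℝ => P.eval y * Real.exp (-y)) _ y := h1.mul h2
    rw [h3.deriv]
    simp only [Polynomial.eval_sub]
    ring

theorem hasTemperateGrowth_polynomial (Q : Polynomial ℝ) :
    Function.HasTemperateGrowth (fun y : ℝ => Q.eval y) := by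
  induction Q using Polynomial.induction_on' with
  | add p q hp hq => simpa using! hp.add hq
  | monomial n a =>
    simp only [Polynomial.eval_monomial]
    fun_prop

theorem exists_gaussian_schwartz :
    ∃ φ : 𝓢(Plane, ℝ), ∀ x, φ x = Real.exp (-(‖x‖ ^ 2) / 2) := by
  have hT : Function.HasTemperateGrowth (fun x : Plane => -(‖x‖ ^ 2) / 2) := by
    have h : (fun x : Plane => -(‖x‖ ^ 2) / 2) = fun x : Plane => (-(1 / 2) : ℝ) * ‖x‖ ^ 2 := by
      funext x
      ring
    rw [h]
    exact (Function.HasTemperateGrowth.const (E := Plane) (-(1 / 2) : ℝ)).mul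
      (Function.hasTemperateGrowth_norm_sq Plane)
  refine ⟨⟨fun x => Real.exp (-(‖x‖ ^ 2) / 2), Real.contDiff_exp.comp hT.1, ?_⟩, fun x => rfl⟩
  intro m n
  obtain ⟨K, C, hC, hb⟩ := hT.norm_iteratedFDeriv_le_uniform n
  have key : ∀ x : Plane,
      ‖iteratedFDeriv ℝ n (fun x : Plane => Real.exp (-(‖x‖ ^ 2) / 2)) x‖ ≤
        n.factorial * Real.exp (-(‖x‖ ^ 2) / 2) * ((1 + C) * (1 + ‖x‖) ^ K) ^ n := by
    intro x
    refine norm_iteratedFDeriv_comp_le (g := Real.exp) (f := fun x : Plane => -(‖x‖ ^ 2) / 2)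
      (N := ((⊤ : ℕ∞) : WithTop ℕ∞)) Real.contDiff_exp hT.1 (mod_cast le_top) x ?_ ?_
    · intro i _
      rw [norm_iteratedFDeriv_eq_norm_iteratedDeriv, iteratedDeriv_eq_iterate,
        Real.iter_deriv_exp, Real.norm_of_nonneg (Real.exp_pos _).le]
    · intro i hi1 hin
      have h1 : (1 : ℝ) ≤ (1 + ‖x‖) ^ K := one_le_pow₀ (by simp)
      have h2 : (1 : ℝ) ≤ (1 + C) * (1 + ‖x‖) ^ K :=
        one_le_mul_of_one_le_of_one_le (by linarith) h1
      calc _ ≤ C * (1 + ‖x‖) ^ K := hb i hin x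
        _ ≤ (1 + C) * (1 + ‖x‖) ^ K := by gcongr; linarith
        _ ≤ _ := le_self_pow₀ h2 (by omega)
  set N : ℕ := m + K * n
  have hexp : ∀ t : ℝ, 0 ≤ t →
      (1 + t) ^ N * Real.exp (-(t ^ 2) / 2) ≤ N.factorial * Real.exp 2 := by
    intro t ht
    have h1 : (1 + t) ^ N ≤ N.factorial * Real.exp (1 + t) := by
      have := Real.pow_div_factorial_le_exp (1 + t) (by linarith) N
      rwa [div_le_iff₀' (by positivity)] at this
    calc _ ≤ (N.factorial * Real.exp (1 + t)) * Real.exp (-(t ^ 2) / 2) := by gcongr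
      _ = N.factorial * Real.exp (1 + t + -(t ^ 2) / 2) := by rw [Real.exp_add (1 + t), mul_assoc]
      _ ≤ _ := by
        gcongr
        nlinarith [sq_nonneg (t - 1)]
  refine ⟨n.factorial * (1 + C) ^ n * (N.factorial * Real.exp 2), fun x => ?_⟩
  calc _ ≤ (1 + ‖x‖) ^ m *
        (n.factorial * Real.exp (-(‖x‖ ^ 2) / 2) * ((1 + C) * (1 + ‖x‖) ^ K) ^ n) := by
        gcongr
        · simp
        · exact key x
    _ = n.factorial * (1 + C) ^ n * ((1 + ‖x‖) ^ N * Real.exp (-(‖x‖ ^ 2) / 2)) := by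
        simp only [N, pow_add, pow_mul, mul_pow]
        ring
    _ ≤ _ := by
        exact mul_le_mul_of_nonneg_left (hexp _ (norm_nonneg _)) (by positivity)

theorem exists_schwartz_eq_eigenfun (k : ℕ) :
    ∃ φ : 𝓢(Plane, ℂ), ∀ x, φ x = (eigenfun k x : ℂ) := by
  obtain ⟨γ, hγ⟩ := exists_gaussian_schwartz
  obtain ⟨Q, hQ⟩ := exists_poly_iteratedDeriv k (Polynomial.X ^ k)
  have hT : Function.HasTemperateGrowth
      (fun x : Plane => (1 / Real.sqrt Real.pi / (k.factorial : ℝ)) * Q.eval (‖x‖ ^ 2)) :=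
    (Function.HasTemperateGrowth.const _).mul
      ((hasTemperateGrowth_polynomial Q).comp (Function.hasTemperateGrowth_norm_sq Plane))
  refine ⟨SchwartzMap.postcompCLM (𝕜 := ℝ) Complex.ofRealCLM (SchwartzMap.smulLeftCLM ℝ
    (fun x : Plane => (1 / Real.sqrt Real.pi / (k.factorial : ℝ)) * Q.eval (‖x‖ ^ 2)) γ),
    fun x => ?_⟩
  have hQ' : iteratedDeriv k (fun y : ℝ => y ^ k * Real.exp (-y)) (‖x‖ ^ 2) =
      Q.eval (‖x‖ ^ 2) * Real.exp (-(‖x‖ ^ 2)) := by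
    have := congrFun hQ (‖x‖ ^ 2)
    simpa using this
  have hE : Real.exp (‖x‖ ^ 2 / 2) * Real.exp (-(‖x‖ ^ 2)) = Real.exp (-(‖x‖ ^ 2) / 2) := by
    rw [← Real.exp_add]
    congr 1
    ring
  rw [SchwartzMap.postcompCLM_apply, SchwartzMap.smulLeftCLM_apply_apply hT, hγ]
  simp only [Complex.ofRealCLM_apply, eigenfun, laguerreFun, hQ', smul_eq_mul]
  rw [← hE]
  congr 1
  ring

/-- The eigenfunction `eₖ` as a (complex valued) Schwartz function. -/
def eigenSchwartz (k : ℕ) : 𝓢(Plane, ℂ) where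
  toFun x := (eigenfun k x : ℂ)
  smooth' := by
    obtain ⟨φ, hφ⟩ := exists_schwartz_eq_eigenfun k
    have h : (fun x => (eigenfun k x : ℂ)) = φ := funext fun x => (hφ x).symm
    rw [h]
    exact φ.smooth'
  decay' := by
    obtain ⟨φ, hφ⟩ := exists_schwartz_eq_eigenfun k
    have h : (fun x => (eigenfun k x : ℂ)) = φ := funext fun x => (hφ x).symm
    rw [h]
    exact φ.decay'

/-- The eigenfunction `eₖ` as a tempered distribution, `φ ↦ ∫ φ eₖ`. -/
def eigenDistribution (k : ℕ) : 𝓢'(Plane, ℂ) :=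
  SchwartzMap.toTemperedDistributionCLM Plane ℂ volume (eigenSchwartz k)

/-! ### Random series and its law on tempered distributions -/

/-- The cylindrical σ-algebra on `𝓢'(ℝ²)`: the smallest one for which all evaluations
`u ↦ u φ` at Schwartz functions are measurable. -/
instance instMeasurableSpaceTempered : MeasurableSpace 𝓢'(Plane, ℂ) :=
  ⨆ φ : 𝓢(Plane, ℂ), MeasurableSpace.comap (fun u : 𝓢'(Plane, ℂ) => u φ) (borel ℂ)

/-- The law of a normalized complex Gaussian: density `π⁻¹ e^{-|z|²}` on `ℂ`. -/
def stdComplexGaussian : Measure ℂ :=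
  volume.withDensity (fun z : ℂ => ENNReal.ofReal (Real.exp (-(‖z‖ ^ 2)) / Real.pi))

/-- The partial sum `∑_{k<n} (4k+2)^{-1/2} gₖ(ω) eₖ` of the random series, in `𝓢'(ℝ²)`. -/
def gaussianPartialSum {Ω : Type*} (g : ℕ → Ω → ℂ) (n : ℕ) (ω : Ω) : 𝓢'(Plane, ℂ) :=
  ∑ k ∈ Finset.range n,
    (g k ω / (Real.sqrt (4 * (k : ℝ) + 2) : ℂ)) • eigenDistribution k

/-! ### Truncated Gibbs densities -/

/-- The projection `u_n° = ∑_{j ≤ n} ⟨u, eⱼ⟩ eⱼ` of a tempered distribution on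
`span {e₀, …, e_n}`, as a function; as `eⱼ` is real, `⟨u, eⱼ⟩` is `u` evaluated at `eⱼ`. -/
def proj (n : ℕ) (u : 𝓢'(Plane, ℂ)) (x : Plane) : ℂ :=
  ∑ j ∈ Finset.range (n + 1), u (eigenSchwartz j) * (eigenfun j x : ℂ)

/-- The `L^q(ℝ²)` norm (finite for every `proj n u`). -/
def lqNorm (q : ℝ) (v : Plane → ℂ) : ℝ :=
  (eLpNorm v (ENNReal.ofReal q) volume).toReal

/-- `α_n = ∑_{j=0}^{n} 1 / (4j + 2)`. -/
def massMean (n : ℕ) : ℝ :=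
  ∑ j ∈ Finset.range (n + 1), 1 / (4 * (j : ℝ) + 2)

/-- `χ` is a cutoff: continuous, compactly supported, and equal to `1` near `0`. -/
def IsCutoff (χ : ℝ → ℝ) : Prop :=
  Continuous χ ∧ HasCompactSupport χ ∧ ∀ᶠ z in 𝓝 (0 : ℝ), χ z = 1

/-- `ρ_n(u) = χ(‖u_n°‖²_{L²} - α_n) exp((2/(p+1)) ‖u_n°‖^{p+1}_{L^{p+1}})`. -/
def truncDensity (p : ℝ) (χ : ℝ → ℝ) (n : ℕ) (u : 𝓢'(Plane, ℂ)) : ℝ :=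
  χ (lqNorm 2 (proj n u) ^ 2 - massMean n) *
    Real.exp (2 / (p + 1) * lqNorm (p + 1) (proj n u) ^ (p + 1))

/-- `ρ` is the limit of the truncated densities `ρ_{2^k}` in `L^r(μ)` for all `1 ≤ r < ∞`. -/
def IsGibbsDensity (p : ℝ) (χ : ℝ → ℝ) (μ : Measure 𝓢'(Plane, ℂ))
    (ρ : 𝓢'(Plane, ℂ) → ℝ) : Prop :=
  ∀ r : ℝ, 1 ≤ r →
    (∀ k : ℕ, MemLp (truncDensity p χ (2 ^ k)) (ENNReal.ofReal r) μ) ∧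
    MemLp ρ (ENNReal.ofReal r) μ ∧
    Tendsto (fun k : ℕ =>
      eLpNorm (fun u => truncDensity p χ (2 ^ k) u - ρ u) (ENNReal.ofReal r) μ) atTop (𝓝 0)

end RadialNLS

end

/-!
By orthonormality of the `e_j`, the coordinates `√(4j+2) ⟨u, e_j⟩` are independent standard complex
Gaussians under `μ`, and `ρ_n` is a function of the renormalized mass
`M_n = ‖u_n°‖² - α_n = ∑_{j ≤ n} (|g_j|² - 1) / (4j+2)` and of `‖u_n°‖_q`, where `q = p + 1 < 4`.
Almost sure convergence of `M_{2^k}` and `‖u_{2^k}°‖_q` together with bounds on all moments of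
`ρ_{2^k}`, uniform in `k`, give the convergence in every `L^r`
(`memLp_and_tendsto_eLpNorm_of_moments`); total variations are `L¹` norms of densities.

The deterministic input is the decay of the eigenfunctions, `∫ e_n⁴ = O(log n / n)`
(`integral_eigenfun_pow_four_le`). It comes from the exact formula
`L_n(x)² = ∑_k a_k a_{n-k} L_{2k}(2x)`, `a_k = 4^{-k} (2k choose k)` (`laguerrePoly_sq`), and the
orthogonality of the Laguerre polynomials. By interpolation with `L²` it gives
* for low frequencies the Bernstein inequality `‖v‖_q^q ≲ ‖v‖₂^q N^{(q-2)/2}`, up to logarithms, for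
  `v` in the span of `e_0, …, e_N` (`lintegral_enorm_radialSum_rpow_le`);
* for high frequencies the smallness `N^{-κ}`, `κ < 1 - 2/q`, in `L^{q/2}` of the variance
  `∑_{j ≥ N} e_j² / (4j+2)` of the Gaussian series (`exists_lintegral_blockVariance_rpow_le`).

Gaussian concentration (`IsGaussianSequence.lintegral_exp_lqNorm_sq_le`) turns the second bound into
Gaussian tails, of variance `N^{-κ}`, for the `L^q` norm of the high-frequency part, whence the almost
sure convergence along dyadic truncations. For the moments, suppose that `|M_n| ≤ C` and
`‖u_n°‖_q ≥ ℓ`, and cut the frequencies at `N = ℓ^β`. Off an event of probability `exp(-N/2)` the mass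
of the low-frequency part is at most `α_N + C + 1 = O(log N)`, so that by Bernstein its `L^q` norm is
less than `ℓ/2` as soon as `β (q-2)/2 < q`; then the high-frequency part has norm at least `ℓ/2`, which
has probability `exp(-c ℓ² N^κ)`. As `q < 4`, one may take `β > q`, and both probabilities are
`exp(-c ℓ^γ)` with `γ > q` (`IsGaussianSequence.exists_measure_tail_le`), which beats `exp(R ℓ^q)`.

The limit is `ρ = χ(M) exp((2/q) V^q)`, where `M` and `V` are the almost sure limits, for all cutoffs at
once. With trapezoidal cutoffs equal to `1` on `[-(m+1), m+1]`, the density `ρ_(m)` does not vanish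
where `|M| ≤ m + 1`, and these events exhaust the space.
-/

noncomputable section

namespace RadialNLS

section

open Polynomial

/-! ### Laguerre polynomials -/

/-- The Laguerre polynomial `L_n = ∑_i (-1)^i (n choose i) X^i / i!`. -/
def laguerrePoly (n : ℕ) : ℝ[X] :=
  ∑ i ∈ Finset.range (n + 1), C ((-1) ^ i * (n.choose i : ℝ) / (i.factorial : ℝ)) * X ^ i

theorem coeff_laguerrePoly (n i : ℕ) :
    (laguerrePoly n).coeff i = (-1) ^ i * (n.choose i : ℝ) / (i.factorial : ℝ) := by
  simp only [laguerrePoly, finsetSum_coeff, coeff_C_mul, coeff_X_pow, mul_ite, mul_one, mul_zero,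
    Finset.sum_ite_eq, Finset.mem_range]
  split_ifs with h
  · rfl
  · rw [Nat.choose_eq_zero_of_lt (by omega)]; simp

theorem laguerrePoly_eval_zero (n : ℕ) : (laguerrePoly n).eval 0 = 1 := by
  rw [← coeff_zero_eq_eval_zero, coeff_laguerrePoly]; simp

theorem laguerrePoly_zero : laguerrePoly 0 = 1 := by simp [laguerrePoly]

theorem laguerreFun_eq (k : ℕ) (z : ℝ) :
    laguerreFun k z = (laguerrePoly k).eval z * Real.exp (-z / 2) := by
  have h1 : iteratedDeriv k (fun y : ℝ => y ^ k * Real.exp (-y)) z =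
      k.factorial * ((laguerrePoly k).eval z * Real.exp (-z)) := by
    rw [iteratedDeriv_fun_mul (by fun_prop) (by fun_prop), ← Finset.sum_range_reflect,
      laguerrePoly, eval_finsetSum, Finset.sum_mul, Finset.mul_sum]
    refine Finset.sum_congr rfl fun i hi => ?_
    have hik : i ≤ k := by simpa [Nat.lt_succ_iff] using hi
    have h2 : iteratedDeriv (k - (k - i)) (fun y : ℝ => Real.exp (-y)) z =
        (-1) ^ i * Real.exp (-z) := by
      rw [Nat.sub_sub_self hik]
      have := congrFun (iteratedDeriv_exp_const_mul i (-1)) z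
      simpa using this
    have h3 : iteratedDeriv (k - i) (fun y : ℝ => y ^ k) z =
        (k.descFactorial (k - i) : ℝ) * z ^ i := by
      rw [iteratedDeriv_eq_iterate, iter_deriv_pow, Nat.sub_sub_self hik]
      congr 1
      rw [Nat.descFactorial_eq_prod_range]
      push_cast
      refine Finset.prod_congr rfl fun j hj => ?_
      rw [Nat.cast_sub]
      have := Finset.mem_range.1 hj
      omega
    rw [show k + 1 - 1 - i = k - i by omega, h2, h3]
    simp only [eval_mul, eval_C, eval_pow, eval_X]
    have h4 : ((k.descFactorial (k - i) : ℕ) : ℝ) * (i.factorial : ℝ) = k.factorial := by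
      have := Nat.factorial_mul_descFactorial (Nat.sub_le k i)
      rw [Nat.sub_sub_self hik] at this
      rw [mul_comm]
      exact_mod_cast this
    rw [Nat.choose_symm hik, ← h4]
    field_simp
  rw [laguerreFun, h1]
  have h5 : Real.exp (z / 2) * Real.exp (-z) = Real.exp (-z / 2) := by
    rw [← Real.exp_add]; ring_nf
  rw [← h5]
  field_simp

theorem coeff_X_mul_derivative (p : ℝ[X]) (i : ℕ) :
    (X * derivative p).coeff i = i * p.coeff i := by
  cases i with
  | zero => simp
  | succ i => rw [coeff_X_mul, coeff_derivative]; push_cast; ring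

theorem derivative_laguerrePoly_succ (n : ℕ) :
    derivative (laguerrePoly (n + 1)) = derivative (laguerrePoly n) - laguerrePoly n := by
  ext i
  simp only [coeff_sub, coeff_derivative, coeff_laguerrePoly, Nat.choose_succ_succ',
    Nat.factorial_succ, pow_succ]
  push_cast
  field_simp
  ring

theorem X_mul_derivative_laguerrePoly_succ (n : ℕ) :
    X * derivative (laguerrePoly (n + 1)) =
      ((n : ℝ[X]) + 1) * (laguerrePoly (n + 1) - laguerrePoly n) := by
  ext i
  rw [coeff_X_mul_derivative, show ((n : ℝ[X]) + 1) = C ((n : ℝ) + 1) by simp, coeff_C_mul,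
    coeff_sub]
  simp only [coeff_laguerrePoly]
  cases i with
  | zero => simp
  | succ i =>
    have h := Nat.add_one_mul_choose_eq n i
    have h' : ((n : ℝ) + 1) * (n.choose i : ℝ) = ((n + 1).choose (i + 1) : ℝ) * ((i : ℝ) + 1) := by
      exact_mod_cast h
    have h2 : ((n + 1).choose (i + 1) : ℝ) = n.choose i + n.choose (i + 1) := by
      rw [Nat.choose_succ_succ']; push_cast; ring
    push_cast
    rw [← sub_eq_zero]
    have : ((i : ℝ) + 1) * ((-1) ^ (i + 1) * ((n + 1).choose (i + 1) : ℝ) / ((i + 1).factorial : ℝ)) -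
      ((n : ℝ) + 1) * ((-1) ^ (i + 1) * ((n + 1).choose (i + 1) : ℝ) / ((i + 1).factorial : ℝ) -
        (-1) ^ (i + 1) * (n.choose (i + 1) : ℝ) / ((i + 1).factorial : ℝ)) =
        ((-1) ^ (i + 1) / ((i + 1).factorial : ℝ)) * (((i : ℝ) + 1) * ((n + 1).choose (i + 1) : ℝ)
          - ((n : ℝ) + 1) * (((n + 1).choose (i + 1) : ℝ) - n.choose (i + 1))) := by ring
    rw [this, h2]
    rw [h2] at h'
    rw [show ((i : ℝ) + 1) * ((n.choose i : ℝ) + n.choose (i + 1)) -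
      ((n : ℝ) + 1) * ((n.choose i : ℝ) + n.choose (i + 1) - n.choose (i + 1)) = 0 by linarith,
      mul_zero]

theorem X_mul_derivative_laguerrePoly (n : ℕ) :
    X * derivative (laguerrePoly n) =
      (n : ℝ[X]) * (laguerrePoly n - laguerrePoly (n - 1)) := by
  cases n with
  | zero => simp [laguerrePoly_zero]
  | succ n => simpa using X_mul_derivative_laguerrePoly_succ n

/-- The three-term recurrence `(n+1) L_{n+1} = (2n+1-X) L_n - n L_{n-1}`. -/
theorem laguerrePoly_recurrence (n : ℕ) :
    ((n : ℝ[X]) + 1) * laguerrePoly (n + 1) =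
      (2 * (n : ℝ[X]) + 1 - X) * laguerrePoly n - (n : ℝ[X]) * laguerrePoly (n - 1) := by
  have h1 := X_mul_derivative_laguerrePoly_succ n
  rw [derivative_laguerrePoly_succ] at h1
  have h2 := X_mul_derivative_laguerrePoly n
  linear_combination -h1 + h2

/-- Laguerre's equation `X L_n'' + (1-X) L_n' + n L_n = 0`. -/
theorem laguerrePoly_ode (n : ℕ) :
    X * derivative (derivative (laguerrePoly n)) + (1 - X) * derivative (laguerrePoly n) +
      (n : ℝ[X]) * laguerrePoly n = 0 := by
  cases n with
  | zero => simp [laguerrePoly_zero]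
  | succ n =>
    have h1 := X_mul_derivative_laguerrePoly_succ n
    have h2 := congrArg derivative h1
    have h3 := derivative_laguerrePoly_succ n
    simp only [derivative_mul, derivative_X, derivative_add, derivative_natCast, derivative_one,
      derivative_sub] at h2
    push_cast
    linear_combination h2 - h1 + ((n : ℝ[X]) + 1) * h3

/-! ### The square of a Laguerre polynomial -/

/-- The operator `w ↦ X² w''' + 3 X (1-X) w'' + (1 - 4X + 2X² + 4nX) w' + (2n - 4nX) w`, the
symmetric square of Laguerre's operator: it annihilates products of two solutions of
Laguerre's equation of degree `n`. -/
def laguerreSymSq (n : ℕ) : ℝ[X] →ₗ[ℝ] ℝ[X] where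
  toFun w := X * (X * derivative (derivative (derivative w))) +
    3 * (X * derivative (derivative w)) - 3 * (X * (X * derivative (derivative w))) +
    derivative w + 4 * (n : ℝ[X]) * (X * derivative w) - 4 * (X * derivative w) +
    2 * (X * (X * derivative w)) + 2 * (n : ℝ[X]) * w - 4 * (n : ℝ[X]) * (X * w)
  map_add' p q := by simp only [derivative_add]; ring
  map_smul' a p := by
    simp only [smul_eq_C_mul, RingHom.id_apply, derivative_C_mul]
    ring

theorem laguerreSymSq_apply (n : ℕ) (w : ℝ[X]) :
    laguerreSymSq n w = X * (X * derivative (derivative (derivative w))) +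
    3 * (X * derivative (derivative w)) - 3 * (X * (X * derivative (derivative w))) +
    derivative w + 4 * (n : ℝ[X]) * (X * derivative w) - 4 * (X * derivative w) +
    2 * (X * (X * derivative w)) + 2 * (n : ℝ[X]) * w - 4 * (n : ℝ[X]) * (X * w) := rfl

theorem laguerreSymSq_sq (n : ℕ) : laguerreSymSq n (laguerrePoly n ^ 2) = 0 := by
  have h1 := laguerrePoly_ode n
  have h2 := congrArg derivative h1
  rw [laguerreSymSq_apply]
  simp only [derivative_mul, derivative_X, derivative_add, derivative_natCast, derivative_one,
    derivative_sub, derivative_pow, derivative_zero, map_natCast] at h2 ⊢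
  set L := laguerrePoly n
  set L1 := derivative L
  set L2 := derivative L1
  set L3 := derivative L2
  push_cast
  linear_combination (2 * X * L) * h2 + (6 * X * L1 + (2 - 4 * X) * L) * h1

/-- The operator sends a leading term `a X^d` to `(2d - 4n) a X^{d+1}`, up to lower order terms. -/
theorem eq_zero_of_laguerreSymSq_eq_zero (n : ℕ) (w : ℝ[X]) (h : laguerreSymSq n w = 0)
    (hc : w.coeff (2 * n) = 0) : w = 0 := by
  by_contra hw
  set d := w.natDegree
  have hd : w.coeff d ≠ 0 := by simpa [d] using hw
  have hd1 : w.coeff (d + 1) = 0 := coeff_eq_zero_of_natDegree_lt (Nat.lt_succ_self _)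
  have hd2 : w.coeff (d + 2) = 0 := coeff_eq_zero_of_natDegree_lt (by omega)
  have h1 := congrArg (fun p => p.coeff (d + 1)) h
  simp only [laguerreSymSq_apply] at h1
  rw [show (3 : ℝ[X]) = C 3 from rfl, show (2 : ℝ[X]) = C 2 from rfl,
    show (4 : ℝ[X]) = C 4 from rfl, ← C_eq_natCast] at h1
  simp only [coeff_add, coeff_sub, coeff_X_mul, mul_assoc, coeff_C_mul, coeff_zero,
    coeff_derivative, coeff_X_mul_derivative, hd1, hd2] at h1
  have hd3 : w.coeff (d + 1 + 1) = 0 := hd2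
  have h2 : ((d : ℝ) - 2 * n) * w.coeff d = 0 := by
    push_cast at h1
    linear_combination (1 / 2) * h1
  rcases mul_eq_zero.1 h2 with h3 | h3
  · have : d = 2 * n := by
      have : (d : ℝ) = ((2 * n : ℕ) : ℝ) := by push_cast; linarith
      exact_mod_cast this
    exact hd (this ▸ hc)
  · exact hd h3

/-- The Laguerre polynomial with doubled argument, `L_m(2X)`. -/
def laguerreTwo (m : ℕ) : ℝ[X] := (laguerrePoly m).comp (2 * X)

theorem coeff_laguerreTwo (m i : ℕ) :
    (laguerreTwo m).coeff i = 2 ^ i * (laguerrePoly m).coeff i := by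
  rw [laguerreTwo, show (2 : ℝ[X]) = C 2 from rfl, comp_C_mul_X_coeff, mul_comm]

theorem X_mul_derivative_laguerreTwo (m : ℕ) :
    X * derivative (laguerreTwo m) =
      (m : ℝ[X]) * (laguerreTwo m - laguerreTwo (m - 1)) := by
  have h := congrArg (fun p => p.comp (2 * X)) (X_mul_derivative_laguerrePoly m)
  simp only [mul_comp, X_comp, natCast_comp, sub_comp] at h
  rw [laguerreTwo, derivative_comp, ← laguerreTwo]
  simp only [derivative_mul, derivative_ofNat, derivative_X]
  rw [laguerreTwo, laguerreTwo, ← h]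
  ring

theorem laguerreTwo_recurrence (n : ℕ) :
    ((n : ℝ[X]) + 1) * laguerreTwo (n + 1) =
      (2 * (n : ℝ[X]) + 1 - 2 * X) * laguerreTwo n - (n : ℝ[X]) * laguerreTwo (n - 1) := by
  have h := congrArg (fun p => p.comp (2 * X)) (laguerrePoly_recurrence n)
  simpa only [laguerreTwo, mul_comp, X_comp, natCast_comp, sub_comp, add_comp, one_comp,
    ofNat_comp, Nat.cast_ofNat] using h

theorem laguerreTwo_ode (n : ℕ) :
    X * derivative (derivative (laguerreTwo n)) + (1 - 2 * X) * derivative (laguerreTwo n) +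
      2 * (n : ℝ[X]) * laguerreTwo n = 0 := by
  have h := congrArg (fun p => p.comp (2 * X)) (laguerrePoly_ode n)
  simp only [mul_comp, X_comp, natCast_comp, sub_comp, add_comp, one_comp, zero_comp] at h
  simp only [laguerreTwo, derivative_comp, derivative_mul, derivative_ofNat, derivative_X,
    derivative_add, derivative_zero, derivative_one]
  linear_combination 2 * h

theorem laguerreSymSq_laguerreTwo (n m : ℕ) :
    laguerreSymSq n (laguerreTwo m) =
      ((m : ℝ[X]) + 1) * (2 * (n : ℝ[X]) - m) * laguerreTwo (m + 1) -
        (m : ℝ[X]) * (2 * (n : ℝ[X]) - m + 1) * laguerreTwo (m - 1) := by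
  have h1 := laguerreTwo_ode m
  have h2 := congrArg derivative h1
  have h3 := X_mul_derivative_laguerreTwo m
  have h4 := laguerreTwo_recurrence m
  rw [laguerreSymSq_apply]
  simp only [derivative_mul, derivative_X, derivative_add, derivative_natCast, derivative_one,
    derivative_sub, derivative_ofNat, derivative_zero] at h2
  set W := laguerreTwo m
  linear_combination X * h2 + (1 - X) * h1 + (4 * (n : ℝ[X]) - 2 * m + 1) * h3 -
    (2 * (n : ℝ[X]) - m) * h4

/-- The normalized central binomial coefficient `4^{-k} (2k choose k)`. -/
def centralWeight (k : ℕ) : ℝ := (k.centralBinom : ℝ) / 4 ^ k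

theorem centralWeight_succ (k : ℕ) :
    centralWeight (k + 1) * (2 * k + 2) = centralWeight k * (2 * k + 1) := by
  have h := Nat.succ_mul_centralBinom_succ k
  have h' : ((k : ℝ) + 1) * ((k + 1).centralBinom : ℝ) = 2 * (2 * k + 1) * k.centralBinom := by
    exact_mod_cast h
  rw [centralWeight, centralWeight, pow_succ]
  field_simp
  linarith

theorem centralWeight_sq_le (k : ℕ) : centralWeight k ^ 2 ≤ 1 / (2 * k + 1) := by
  induction k with
  | zero => simp [centralWeight]
  | succ k ih =>
    have h := centralWeight_succ k
    have h1 : centralWeight (k + 1) = centralWeight k * ((2 * k + 1) / (2 * k + 2)) := by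
      field_simp; linarith
    rw [h1, mul_pow]
    calc _ ≤ 1 / (2 * (k : ℝ) + 1) * ((2 * k + 1) / (2 * k + 2)) ^ 2 := by gcongr
      _ ≤ _ := by
        rw [div_pow, div_mul_div_comm, div_le_div_iff₀ (by positivity) (by positivity)]
        push_cast
        have : (0 : ℝ) ≤ k := by positivity
        nlinarith [mul_nonneg this this]

/-- The square of a Laguerre polynomial in terms of Laguerre polynomials of doubled argument:
`L_n(x)² = ∑_{k ≤ n} a_k a_{n-k} L_{2k}(2x)` with `a_k = 4^{-k} (2k choose k)`. Both sides are
annihilated by `laguerreSymSq n` (the sum telescopes) and have the same leading coefficient. -/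
theorem laguerrePoly_sq (n : ℕ) :
    laguerrePoly n ^ 2 = ∑ k ∈ Finset.range (n + 1),
      (centralWeight k * centralWeight (n - k)) • laguerreTwo (2 * k) := by
  have htel : ∀ K ≤ n, ∑ k ∈ Finset.range (K + 1), (centralWeight k * centralWeight (n - k)) •
      laguerreSymSq n (laguerreTwo (2 * k)) =
      (centralWeight K * centralWeight (n - K) * (2 * K + 1) * (2 * (n : ℝ) - 2 * K)) •
        laguerreTwo (2 * K + 1) := by
    intro K hK
    induction K with
    | zero =>
      simp only [zero_add, Finset.sum_range_one, laguerreSymSq_laguerreTwo, smul_eq_C_mul]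
      simp [show (C 2 : ℝ[X]) = 2 from rfl]
      ring
    | succ K ih =>
      rw [Finset.sum_range_succ, ih (by omega), laguerreSymSq_laguerreTwo]
      obtain ⟨r, rfl⟩ : ∃ r, n = K + 1 + r := ⟨n - (K + 1), by omega⟩
      rw [show K + 1 + r - K = r + 1 by omega, show K + 1 + r - (K + 1) = r by omega,
        show 2 * (K + 1) - 1 = 2 * K + 1 by omega]
      have h1 := centralWeight_succ K
      have h2 := centralWeight_succ r
      have h3 : centralWeight K * centralWeight (r + 1) * (2 * K + 1) *
          (2 * ((K + 1 + r : ℕ) : ℝ) - 2 * K) = centralWeight (K + 1) * centralWeight r *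
          (2 * K + 2) * (2 * r + 1) := by
        push_cast
        linear_combination (-centralWeight (r + 1) * (2 * r + 2)) * h1 +
          centralWeight (K + 1) * (2 * K + 2) * h2
      rw [h3]
      simp only [smul_eq_C_mul, C_mul, C_add, C_sub, C_1, C_eq_natCast]
      push_cast
      simp only [show (C 2 : ℝ[X]) = 2 from rfl]
      ring
  rw [← sub_eq_zero]
  apply eq_zero_of_laguerreSymSq_eq_zero n
  · rw [map_sub, laguerreSymSq_sq, map_sum]
    simp only [map_smul]
    rw [htel n le_rfl]
    simp
  · rw [coeff_sub, sub_eq_zero]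
    have hdeg : (laguerrePoly n).natDegree ≤ n := by
      rw [natDegree_le_iff_coeff_eq_zero]
      intro N hN
      rw [coeff_laguerrePoly, Nat.choose_eq_zero_of_lt hN]; simp
    rw [coeff_pow_of_natDegree_le hdeg, finsetSum_coeff,
      Finset.sum_eq_single n]
    · simp only [coeff_smul, coeff_laguerreTwo, coeff_laguerrePoly, smul_eq_mul]
      have h := Nat.centralBinom_eq_two_mul_choose n
      have h5 : ((2 * n).factorial : ℝ) = n.centralBinom * n.factorial * n.factorial := by
        have := Nat.choose_mul_factorial_mul_factorial (show n ≤ 2 * n by omega)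
        rw [← h, show 2 * n - n = n by omega] at this
        exact_mod_cast this.symm
      have h6 : (n.centralBinom : ℝ) ≠ 0 := by exact_mod_cast Nat.centralBinom_ne_zero n
      simp [centralWeight, h5]
      rw [pow_mul, show ((2 : ℝ) ^ 2) = 4 by norm_num]
      field_simp
      rw [← pow_mul, mul_comm, pow_mul]; norm_num
    · intro k hk hkn
      have : k < n := by
        have := Finset.mem_range.1 hk
        omega
      simp only [coeff_smul, coeff_laguerreTwo, coeff_laguerrePoly, smul_eq_mul]
      rw [Nat.choose_eq_zero_of_lt (by omega)]; simp
    · simp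

/-! ### Orthogonality of Laguerre polynomials -/

/-- The linear functional `Q ↦ ∫₀^∞ Q(z) e^{-z} dz`, given by `X^i ↦ i!`. -/
def gammaFunctional : ℝ[X] →ₗ[ℝ] ℝ :=
  Polynomial.lsum fun i => (i.factorial : ℝ) • LinearMap.id

theorem gammaFunctional_monomial (i : ℕ) (a : ℝ) :
    gammaFunctional (monomial i a) = i.factorial * a := by
  simp [gammaFunctional, Polynomial.lsum_apply]

/-- Integration by parts. -/
theorem gammaFunctional_derivative (p : ℝ[X]) :
    gammaFunctional (derivative p) = gammaFunctional p - p.eval 0 := by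
  induction p using Polynomial.induction_on' with
  | add p q hp hq => simp only [map_add, hp, hq, eval_add]; ring
  | monomial i a =>
    rw [derivative_monomial, gammaFunctional_monomial, gammaFunctional_monomial]
    cases i with
    | zero => simp
    | succ i => simp [Nat.factorial_succ]; ring

theorem gammaFunctional_laguerrePoly_mul_of_ne {i j : ℕ} (hij : i ≠ j) :
    gammaFunctional (laguerrePoly i * laguerrePoly j) = 0 := by
  -- the Wronskian `V` satisfies `V' = V + (j - i) L_i L_j` by Laguerre's equation
  set V := X * (derivative (laguerrePoly i) * laguerrePoly j -
    laguerrePoly i * derivative (laguerrePoly j)) with hV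
  have h0 : V.eval 0 = 0 := by simp [hV]
  have h1 : derivative V = V + ((j : ℝ) - i) • (laguerrePoly i * laguerrePoly j) := by
    have hi := laguerrePoly_ode i
    have hj := laguerrePoly_ode j
    rw [smul_eq_C_mul, C_sub, C_eq_natCast, C_eq_natCast, hV]
    simp only [derivative_mul, derivative_X, derivative_sub]
    linear_combination laguerrePoly j * hi - laguerrePoly i * hj
  have h2 := gammaFunctional_derivative V
  rw [h1, map_add, map_smul, h0, smul_eq_mul] at h2
  have h3 : ((j : ℝ) - i) ≠ 0 := by
    rw [sub_ne_zero]; exact_mod_cast hij.symm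
  exact (mul_eq_zero.1 (by linarith : ((j : ℝ) - i) *
    gammaFunctional (laguerrePoly i * laguerrePoly j) = 0)).resolve_left h3

theorem gammaFunctional_laguerrePoly_mul_derivative {m n : ℕ} (h : n ≤ m) :
    gammaFunctional (laguerrePoly m * derivative (laguerrePoly n)) = 0 := by
  induction n with
  | zero => simp [laguerrePoly_zero]
  | succ n ih =>
    rw [derivative_laguerrePoly_succ, mul_sub, map_sub, ih (by omega),
      gammaFunctional_laguerrePoly_mul_of_ne (by omega), sub_zero]

theorem gammaFunctional_laguerrePoly_mul_self (n : ℕ) :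
    gammaFunctional (laguerrePoly n * laguerrePoly n) = 1 := by
  induction n with
  | zero =>
    have := gammaFunctional_monomial 0 1
    simpa [laguerrePoly_zero] using this
  | succ n ih =>
    have h := gammaFunctional_derivative
      ((laguerrePoly (n + 1) - laguerrePoly n) * laguerrePoly (n + 1))
    have e1 : derivative ((laguerrePoly (n + 1) - laguerrePoly n) * laguerrePoly (n + 1)) =
        laguerrePoly (n + 1) * derivative (laguerrePoly (n + 1)) -
        laguerrePoly n * laguerrePoly (n + 1) - laguerrePoly n * derivative (laguerrePoly n) +
        laguerrePoly n * laguerrePoly n := by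
      simp only [derivative_mul, derivative_sub, derivative_laguerrePoly_succ n]
      ring
    rw [e1, sub_mul] at h
    simp only [map_add, map_sub, eval_sub, eval_mul, laguerrePoly_eval_zero] at h
    rw [gammaFunctional_laguerrePoly_mul_derivative le_rfl,
      gammaFunctional_laguerrePoly_mul_derivative le_rfl,
      gammaFunctional_laguerrePoly_mul_of_ne (Nat.lt_succ_self n).ne, ih] at h
    linarith

theorem gammaFunctional_laguerrePoly_mul (i j : ℕ) :
    gammaFunctional (laguerrePoly i * laguerrePoly j) = if i = j then 1 else 0 := by
  split_ifs with h
  · rw [h, gammaFunctional_laguerrePoly_mul_self]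
  · exact gammaFunctional_laguerrePoly_mul_of_ne h

/-! ### Integrals of radial functions over the plane -/

theorem integral_norm_pow_mul_exp (s : ℝ) (hs : 0 < s) (i : ℕ) :
    ∫ x : Plane, (‖x‖ ^ 2) ^ i * Real.exp (-s * ‖x‖ ^ 2) =
      Real.pi * i.factorial / s ^ (i + 1) := by
  rw [integral_fun_norm_addHaar (volume : Measure Plane)
    (fun y => (y ^ 2) ^ i * Real.exp (-s * y ^ 2))]
  have h1 : ∫ y in Set.Ioi (0 : ℝ), y ^ (Module.finrank ℝ Plane - 1) •
      ((y ^ 2) ^ i * Real.exp (-s * y ^ 2)) = i.factorial / (2 * s ^ (i + 1)) := by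
    have h2 := integral_rpow_mul_exp_neg_mul_rpow (p := 2) (q := 2 * i + 1) (b := s) (by norm_num)
      (by have : (0 : ℝ) ≤ i := by positivity
          linarith) hs
    have h3 : ∫ y in Set.Ioi (0 : ℝ), y ^ (Module.finrank ℝ Plane - 1) •
      ((y ^ 2) ^ i * Real.exp (-s * y ^ 2)) =
        ∫ x in Set.Ioi (0 : ℝ), x ^ (2 * (i : ℝ) + 1) * Real.exp (-s * x ^ (2 : ℝ)) := by
      refine setIntegral_congr_fun measurableSet_Ioi fun y hy => ?_
      have hy' : (0 : ℝ) < y := hy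
      have e1 : y ^ (2 * (i : ℝ) + 1) = y * (y ^ 2) ^ i := by
        rw [Real.rpow_add hy', Real.rpow_one, ← pow_mul, mul_comm]
        congr 1
        exact_mod_cast Real.rpow_natCast y (2 * i)
      simp only [finrank_euclideanSpace, Fintype.card_fin, smul_eq_mul]
      rw [e1, Real.rpow_two]
      ring
    rw [h3, h2, show ((2 * (i : ℝ) + 1 + 1) / 2) = (i : ℝ) + 1 by ring, Real.Gamma_nat_eq_factorial,
      show (-(2 * (i : ℝ) + 1 + 1) / 2) = -((i + 1 : ℕ) : ℝ) by push_cast; ring,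
      Real.rpow_neg hs.le, Real.rpow_natCast]
    field_simp
  rw [h1]
  have h4 : (volume : Measure Plane).real (Metric.ball 0 1) = Real.pi := by
    rw [Measure.real, EuclideanSpace.volume_ball_fin_two]
    simp [Real.pi_pos.le]
  rw [h4]
  simp only [finrank_euclideanSpace, Fintype.card_fin, smul_eq_mul, nsmul_eq_mul]
  push_cast
  field_simp

theorem integrable_norm_pow_mul_exp (s : ℝ) (hs : 0 < s) (i : ℕ) :
    Integrable (fun x : Plane => (‖x‖ ^ 2) ^ i * Real.exp (-s * ‖x‖ ^ 2)) := by
  apply Integrable.of_integral_ne_zero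
  rw [integral_norm_pow_mul_exp s hs]
  have := Real.pi_pos
  positivity

/-- Integration of `Q(s|x|²) e^{-s|x|²}` over the plane. -/
theorem integral_polynomial_mul_exp (s : ℝ) (hs : 0 < s) (Q : ℝ[X]) :
    Integrable (fun x : Plane => Q.eval (s * ‖x‖ ^ 2) * Real.exp (-s * ‖x‖ ^ 2)) ∧
    ∫ x : Plane, Q.eval (s * ‖x‖ ^ 2) * Real.exp (-s * ‖x‖ ^ 2) =
      Real.pi / s * gammaFunctional Q := by
  induction Q using Polynomial.induction_on' with
  | add p q hp hq =>
    simp only [eval_add, add_mul, map_add, mul_add]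
    exact ⟨hp.1.add hq.1, by rw [integral_add hp.1 hq.1, hp.2, hq.2]⟩
  | monomial i a =>
    have e : (fun x : Plane => (monomial i a).eval (s * ‖x‖ ^ 2) * Real.exp (-s * ‖x‖ ^ 2)) =
        fun x => (a * s ^ i) * ((‖x‖ ^ 2) ^ i * Real.exp (-s * ‖x‖ ^ 2)) := by
      funext x
      rw [eval_monomial, mul_pow]
      ring
    rw [e]
    refine ⟨(integrable_norm_pow_mul_exp s hs i).const_mul _, ?_⟩
    rw [integral_const_mul, integral_norm_pow_mul_exp s hs, gammaFunctional_monomial]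
    field_simp
    ring

theorem eigenfun_eq (k : ℕ) (x : Plane) :
    eigenfun k x =
      1 / Real.sqrt Real.pi * ((laguerrePoly k).eval (‖x‖ ^ 2) * Real.exp (-(‖x‖ ^ 2) / 2)) := by
  rw [eigenfun, laguerreFun_eq]

theorem integral_eigenfun_mul (i j : ℕ) :
    ∫ x : Plane, eigenfun i x * eigenfun j x = if i = j then 1 else 0 := by
  have h := (integral_polynomial_mul_exp 1 one_pos (laguerrePoly i * laguerrePoly j)).2
  rw [gammaFunctional_laguerrePoly_mul] at h
  have e : ∀ x : Plane, eigenfun i x * eigenfun j x = (1 / Real.pi) *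
      ((laguerrePoly i * laguerrePoly j).eval (1 * ‖x‖ ^ 2) * Real.exp (-1 * ‖x‖ ^ 2)) := by
    intro x
    have e1 : Real.exp (-1 * ‖x‖ ^ 2) =
        Real.exp (-(‖x‖ ^ 2) / 2) * Real.exp (-(‖x‖ ^ 2) / 2) := by
      rw [← Real.exp_add]; ring_nf
    have e2 : (1 / Real.pi) = (1 / Real.sqrt Real.pi) * (1 / Real.sqrt Real.pi) := by
      rw [div_mul_div_comm, Real.mul_self_sqrt Real.pi_pos.le, one_mul]
    rw [eigenfun_eq, eigenfun_eq, eval_mul, one_mul, e1, e2]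
    ring
  simp_rw [e]
  rw [integral_const_mul, h]
  have := Real.pi_ne_zero
  split_ifs <;> field_simp

theorem integral_eigenfun_pow_four_eq (n : ℕ) :
    ∫ x : Plane, eigenfun n x ^ 4 = 1 / (2 * Real.pi) *
      ∑ k ∈ Finset.range (n + 1), (centralWeight k * centralWeight (n - k)) ^ 2 := by
  set R : ℝ[X] := ∑ k ∈ Finset.range (n + 1),
    (centralWeight k * centralWeight (n - k)) • laguerrePoly (2 * k) with hR
  have hsq : laguerrePoly n ^ 2 = R.comp (2 * X) := by
    rw [laguerrePoly_sq, hR, Polynomial.sum_comp]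
    simp [laguerreTwo]
  have h := (integral_polynomial_mul_exp 2 two_pos (R * R)).2
  have hG : gammaFunctional (R * R) =
      ∑ k ∈ Finset.range (n + 1), (centralWeight k * centralWeight (n - k)) ^ 2 := by
    rw [hR, Finset.sum_mul_sum, map_sum]
    refine Finset.sum_congr rfl fun k hk => ?_
    rw [map_sum, Finset.sum_eq_single k]
    · rw [smul_mul_smul_comm, map_smul, gammaFunctional_laguerrePoly_mul, if_pos rfl, smul_eq_mul]
      ring
    · intro l _ hl
      rw [smul_mul_smul_comm, map_smul, gammaFunctional_laguerrePoly_mul, if_neg (by omega),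
        smul_zero]
    · intro hk'; exact absurd hk hk'
  rw [hG] at h
  have e : ∀ x : Plane, eigenfun n x ^ 4 = (1 / Real.pi ^ 2) *
      ((R * R).eval (2 * ‖x‖ ^ 2) * Real.exp (-2 * ‖x‖ ^ 2)) := by
    intro x
    have e1 : Real.exp (-2 * ‖x‖ ^ 2) = Real.exp (-(‖x‖ ^ 2) / 2) ^ 4 := by
      rw [← Real.exp_nat_mul]; push_cast; ring_nf
    have e2 : (1 / Real.pi ^ 2) = (1 / Real.sqrt Real.pi) ^ 4 := by
      rw [div_pow, show 4 = 2 * 2 from rfl, pow_mul (Real.sqrt Real.pi),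
        Real.sq_sqrt Real.pi_pos.le, one_pow]
    have e3 : R.eval (2 * ‖x‖ ^ 2) = (laguerrePoly n).eval (‖x‖ ^ 2) ^ 2 := by
      rw [← eval_pow, hsq, eval_comp]; simp
    rw [eigenfun_eq, eval_mul, e1, e2, e3]
    ring
  simp_rw [e]
  rw [integral_const_mul, h]
  have := Real.pi_ne_zero
  field_simp

/-- The `L⁴` bound `∫ e_n⁴ ≤ α_n / (π (n+1))`, hence `O(log n / n)`. -/
theorem integral_eigenfun_pow_four_le (n : ℕ) :
    ∫ x : Plane, eigenfun n x ^ 4 ≤ massMean n / (Real.pi * (n + 1)) := by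
  rw [integral_eigenfun_pow_four_eq]
  have h1 : ∑ k ∈ Finset.range (n + 1), (centralWeight k * centralWeight (n - k)) ^ 2 ≤
      ∑ k ∈ Finset.range (n + 1), (1 / (n + 1 : ℝ)) *
        (1 / (4 * (k : ℝ) + 2) + 1 / (4 * ((n - k : ℕ) : ℝ) + 2)) := by
    refine Finset.sum_le_sum fun k hk => ?_
    have hk' : k ≤ n := by have := Finset.mem_range.1 hk; omega
    rw [mul_pow]
    calc _ ≤ 1 / (2 * (k : ℝ) + 1) * (1 / (2 * ((n - k : ℕ) : ℝ) + 1)) :=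
          mul_le_mul (centralWeight_sq_le k) (centralWeight_sq_le _) (sq_nonneg _) (by positivity)
      _ = _ := by
          obtain ⟨r, rfl⟩ := Nat.exists_eq_add_of_le hk'
          rw [Nat.add_sub_cancel_left]
          push_cast
          field_simp
          ring
  have h2 : ∑ k ∈ Finset.range (n + 1), 1 / (4 * ((n - k : ℕ) : ℝ) + 2) = massMean n := by
    rw [massMean, ← Finset.sum_range_reflect]
    refine Finset.sum_congr rfl fun k hk => ?_
    have := Finset.mem_range.1 hk
    rw [show n - (n + 1 - 1 - k) = k by omega]
  rw [← Finset.mul_sum, Finset.sum_add_distrib, h2] at h1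
  change _ ≤ 1 / (n + 1 : ℝ) * (massMean n + massMean n) at h1
  have hpi := Real.pi_pos
  calc _ ≤ 1 / (2 * Real.pi) * (1 / (n + 1 : ℝ) * (massMean n + massMean n)) := by gcongr
    _ = _ := by field_simp; ring

theorem massMean_nonneg (n : ℕ) : 0 ≤ massMean n := by
  unfold massMean; positivity

theorem massMean_le_rpow {ε : ℝ} (hε : 0 < ε) (n : ℕ) :
    massMean n ≤ (1 + 1 / ε) * ((n : ℝ) + 1) ^ ε := by
  have h1 : massMean n ≤ (harmonic (n + 1) : ℝ) := by
    rw [massMean, harmonic]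
    push_cast
    refine Finset.sum_le_sum fun k _ => ?_
    rw [one_div]
    apply inv_anti₀ (by positivity)
    have : (0 : ℝ) ≤ k := by positivity
    linarith
  have h2 := harmonic_le_one_add_log (n + 1)
  push_cast at h2
  have h3 := Real.log_le_rpow_div (x := (n : ℝ) + 1) (by positivity) hε
  have h4 : (1 : ℝ) ≤ ((n : ℝ) + 1) ^ ε := Real.one_le_rpow (by simp) hε.le
  rw [add_mul, one_mul, one_div, inv_mul_eq_div]
  linarith

end

/-! ### Lebesgue norms of finite radial sums -/

/-- The finite radial sum `∑_{j ∈ s} c_j e_j`. -/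
def radialSum (s : Finset ℕ) (c : ℕ → ℂ) (x : Plane) : ℂ :=
  ∑ j ∈ s, c j * (eigenfun j x : ℂ)

theorem eigenSchwartz_apply (k : ℕ) (x : Plane) : eigenSchwartz k x = (eigenfun k x : ℂ) := rfl

theorem continuous_eigenfun (k : ℕ) : Continuous (eigenfun k) := by
  have h : Continuous fun x => (eigenSchwartz k x).re :=
    Complex.continuous_re.comp (eigenSchwartz k).continuous
  simpa [eigenSchwartz_apply] using h

theorem memLp_ofReal_eigenfun (k : ℕ) (q : ℝ≥0∞) :
    MemLp (fun x : Plane => (eigenfun k x : ℂ)) q volume :=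
  (eigenSchwartz k).memLp q volume

theorem memLp_eigenfun (k : ℕ) (q : ℝ≥0∞) : MemLp (eigenfun k) q volume := by
  simpa using (memLp_ofReal_eigenfun k q).re

theorem integrable_eigenfun_mul (i j : ℕ) :
    Integrable (fun x : Plane => eigenfun i x * eigenfun j x) :=
  (memLp_eigenfun i 2).integrable_mul (memLp_eigenfun j 2)

theorem integrable_eigenfun_pow_four (k : ℕ) :
    Integrable (fun x : Plane => eigenfun k x ^ 4) := by
  have h := (memLp_eigenfun k 4).integrable_norm_pow (by norm_num)
  refine h.congr (ae_of_all _ fun x => ?_)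
  simp only [Real.norm_eq_abs]
  exact Even.pow_abs (by decide) _

theorem continuous_radialSum (s : Finset ℕ) (c : ℕ → ℂ) : Continuous (radialSum s c) :=
  continuous_finsetSum _ fun j _ =>
    continuous_const.mul (Complex.continuous_ofReal.comp (continuous_eigenfun j))

theorem memLp_radialSum (s : Finset ℕ) (c : ℕ → ℂ) (q : ℝ≥0∞) :
    MemLp (radialSum s c) q volume :=
  memLp_finsetSum s fun j _ => (memLp_ofReal_eigenfun j q).const_mul (c j)

theorem ofReal_lqNorm_rpow {q : ℝ} (hq : 0 < q) {v : Plane → ℂ}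
    (hv : MemLp v (ENNReal.ofReal q) volume) :
    ENNReal.ofReal (lqNorm q v ^ q) = ∫⁻ x, ‖v x‖ₑ ^ q := by
  have h0 : ENNReal.ofReal q ≠ 0 := by simpa using hq
  rw [lqNorm, ← ENNReal.ofReal_rpow_of_nonneg ENNReal.toReal_nonneg hq.le,
    ENNReal.ofReal_toReal hv.2.ne, eLpNorm_eq_lintegral_rpow_enorm_toReal h0 ENNReal.ofReal_ne_top,
    ENNReal.toReal_ofReal hq.le, ← ENNReal.rpow_mul, one_div, inv_mul_cancel₀ hq.ne',
    ENNReal.rpow_one]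

theorem lqNorm_nonneg (q : ℝ) (v : Plane → ℂ) : 0 ≤ lqNorm q v := ENNReal.toReal_nonneg

theorem integral_norm_radialSum_sq (s : Finset ℕ) (c : ℕ → ℂ) :
    Integrable (fun x => ‖radialSum s c x‖ ^ 2) ∧
    ∫ x, ‖radialSum s c x‖ ^ 2 = ∑ j ∈ s, ‖c j‖ ^ 2 := by
  have e : ∀ x, ‖radialSum s c x‖ ^ 2 = ∑ i ∈ s, ∑ j ∈ s,
      (c i * (starRingEnd ℂ) (c j)).re * (eigenfun i x * eigenfun j x) := by
    intro x
    have h1 : ((‖radialSum s c x‖ ^ 2 : ℝ) : ℂ) = ∑ i ∈ s, ∑ j ∈ s,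
        (c i * (starRingEnd ℂ) (c j)) * ((eigenfun i x * eigenfun j x : ℝ) : ℂ) := by
      push_cast
      rw [← Complex.mul_conj', radialSum, map_sum, Finset.sum_mul_sum]
      refine Finset.sum_congr rfl fun i _ => Finset.sum_congr rfl fun j _ => ?_
      rw [map_mul, Complex.conj_ofReal]
      ring
    have h2 := congrArg Complex.re h1
    rw [Complex.ofReal_re, Complex.re_sum] at h2
    rw [h2]
    refine Finset.sum_congr rfl fun i _ => ?_
    rw [Complex.re_sum]
    exact Finset.sum_congr rfl fun j _ => Complex.re_mul_ofReal _ _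
  have hint : ∀ i j, Integrable (fun x =>
      (c i * (starRingEnd ℂ) (c j)).re * (eigenfun i x * eigenfun j x)) := fun i j =>
    (integrable_eigenfun_mul i j).const_mul _
  simp_rw [e]
  refine ⟨integrable_finsetSum _ fun i _ => integrable_finsetSum _ fun j _ => hint i j, ?_⟩
  rw [integral_finsetSum _ fun i _ => integrable_finsetSum _ fun j _ => hint i j]
  refine Finset.sum_congr rfl fun i hi => ?_
  rw [integral_finsetSum _ fun j _ => hint i j, Finset.sum_eq_single i]
  · rw [integral_const_mul, integral_eigenfun_mul, if_pos rfl, mul_one, Complex.mul_conj']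
    norm_cast
  · intro j _ hj
    rw [integral_const_mul, integral_eigenfun_mul, if_neg hj.symm, mul_zero]
  · intro h; exact absurd hi h

theorem lqNorm_two_radialSum_sq (s : Finset ℕ) (c : ℕ → ℂ) :
    lqNorm 2 (radialSum s c) ^ 2 = ∑ j ∈ s, ‖c j‖ ^ 2 := by
  have h1 := ofReal_lqNorm_rpow two_pos (memLp_radialSum s c (ENNReal.ofReal 2))
  have h2 := integral_norm_radialSum_sq s c
  have h3 := ofReal_integral_eq_lintegral_ofReal h2.1 (ae_of_all _ fun x => by positivity)
  have h4 : ∀ x, ENNReal.ofReal (‖radialSum s c x‖ ^ 2) = ‖radialSum s c x‖ₑ ^ (2 : ℝ) := by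
    intro x
    rw [ENNReal.ofReal_pow (norm_nonneg _), ofReal_norm, ENNReal.rpow_two]
  simp_rw [h4] at h3
  rw [← h3, h2.2, ENNReal.ofReal_eq_ofReal_iff (Real.rpow_nonneg (lqNorm_nonneg _ _) _)
    (by positivity), Real.rpow_two] at h1
  exact h1

theorem lintegral_enorm_radialSum_pow_four_le (s : Finset ℕ) (c : ℕ → ℂ) :
    ∫⁻ x, ‖radialSum s c x‖ₑ ^ (4 : ℝ) ≤ ENNReal.ofReal ((∑ j ∈ s, ‖c j‖ ^ 2) ^ 2 *
      (s.card * ∑ j ∈ s, ∫ x : Plane, eigenfun j x ^ 4)) := by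
  have hpt : ∀ x, ‖radialSum s c x‖ₑ ^ (4 : ℝ) ≤ ENNReal.ofReal ((∑ j ∈ s, ‖c j‖ ^ 2) ^ 2 *
      (s.card * ∑ j ∈ s, eigenfun j x ^ 4)) := by
    intro x
    have h1 : ‖radialSum s c x‖ ^ 2 ≤ (∑ j ∈ s, ‖c j‖ ^ 2) * ∑ j ∈ s, eigenfun j x ^ 2 := by
      have h2 : ‖radialSum s c x‖ ≤ ∑ j ∈ s, ‖c j‖ * |eigenfun j x| := by
        refine (norm_sum_le _ _).trans (Finset.sum_le_sum fun j _ => ?_)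
        rw [norm_mul, Complex.norm_real, Real.norm_eq_abs]
      calc _ ≤ (∑ j ∈ s, ‖c j‖ * |eigenfun j x|) ^ 2 := by gcongr
        _ ≤ _ := by
          have := Finset.sum_mul_sq_le_sq_mul_sq s (fun j => ‖c j‖) (fun j => |eigenfun j x|)
          simpa [sq_abs] using this
    have h3 : (∑ j ∈ s, eigenfun j x ^ 2) ^ 2 ≤ s.card * ∑ j ∈ s, eigenfun j x ^ 4 := by
      have := sq_sum_le_card_mul_sum_sq (s := s) (f := fun j => eigenfun j x ^ 2)
      simpa [← pow_mul] using this
    have h4 : ‖radialSum s c x‖ₑ ^ (4 : ℝ) = ENNReal.ofReal ((‖radialSum s c x‖ ^ 2) ^ 2) := by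
      rw [← pow_mul, ENNReal.ofReal_pow (norm_nonneg _), ofReal_norm]
      exact_mod_cast ENNReal.rpow_natCast _ 4
    rw [h4]
    apply ENNReal.ofReal_le_ofReal
    calc _ ≤ ((∑ j ∈ s, ‖c j‖ ^ 2) * ∑ j ∈ s, eigenfun j x ^ 2) ^ 2 := by gcongr
      _ ≤ _ := by rw [mul_pow]; gcongr
  refine (lintegral_mono hpt).trans ?_
  have hi : Integrable (fun x : Plane => (∑ j ∈ s, ‖c j‖ ^ 2) ^ 2 *
      (s.card * ∑ j ∈ s, eigenfun j x ^ 4)) :=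
    ((integrable_finsetSum s fun j _ => integrable_eigenfun_pow_four j).const_mul _).const_mul _
  rw [← ofReal_integral_eq_lintegral_ofReal hi (ae_of_all _ fun x => by positivity),
    integral_const_mul, integral_const_mul,
    integral_finsetSum _ fun j _ => integrable_eigenfun_pow_four j]

theorem integral_eigenfun_pow_four_nonneg (j : ℕ) : 0 ≤ ∫ x : Plane, eigenfun j x ^ 4 :=
  integral_nonneg fun x => by positivity

/-- A Bernstein type inequality, by interpolation between `L²` and `L⁴`. -/
theorem lintegral_enorm_radialSum_rpow_le {q : ℝ} (hq2 : 2 ≤ q) (hq4 : q ≤ 4) (s : Finset ℕ)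
    (c : ℕ → ℂ) :
    ∫⁻ x, ‖radialSum s c x‖ₑ ^ q ≤ ENNReal.ofReal ((∑ j ∈ s, ‖c j‖ ^ 2) ^ (q / 2) *
      (s.card * ∑ j ∈ s, ∫ x : Plane, eigenfun j x ^ 4) ^ ((q - 2) / 2)) := by
  have hm : Measurable fun x => ‖radialSum s c x‖ₑ := (continuous_radialSum s c).enorm.measurable
  have h := ENNReal.lintegral_mul_norm_pow_le (μ := (volume : Measure Plane))
    (hm.pow_const (2 : ℝ)).aemeasurable (hm.pow_const (4 : ℝ)).aemeasurable
    (p := (4 - q) / 2) (q := (q - 2) / 2) (by linarith) (by linarith) (by ring)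
  have e : ∀ x, (‖radialSum s c x‖ₑ ^ (2 : ℝ)) ^ ((4 - q) / 2) *
      (‖radialSum s c x‖ₑ ^ (4 : ℝ)) ^ ((q - 2) / 2) = ‖radialSum s c x‖ₑ ^ q := by
    intro x
    rw [← ENNReal.rpow_mul, ← ENNReal.rpow_mul, ← ENNReal.rpow_add_of_nonneg _ _ (by linarith)
      (by linarith)]
    congr 1
    ring
  simp_rw [e] at h
  have hE : 0 ≤ ∑ j ∈ s, ∫ x : Plane, eigenfun j x ^ 4 :=
    Finset.sum_nonneg fun j _ => integral_eigenfun_pow_four_nonneg j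
  have hm0 : 0 ≤ ∑ j ∈ s, ‖c j‖ ^ 2 := by positivity
  have h2 : ∫⁻ x, ‖radialSum s c x‖ₑ ^ (2 : ℝ) = ENNReal.ofReal (∑ j ∈ s, ‖c j‖ ^ 2) := by
    rw [← ofReal_lqNorm_rpow two_pos (memLp_radialSum s c (ENNReal.ofReal 2)), Real.rpow_two,
      lqNorm_two_radialSum_sq]
  refine h.trans ?_
  rw [h2]
  calc _ ≤ ENNReal.ofReal (∑ j ∈ s, ‖c j‖ ^ 2) ^ ((4 - q) / 2) *
        (ENNReal.ofReal ((∑ j ∈ s, ‖c j‖ ^ 2) ^ 2 *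
          (s.card * ∑ j ∈ s, ∫ x : Plane, eigenfun j x ^ 4))) ^ ((q - 2) / 2) := by
        gcongr
        exact lintegral_enorm_radialSum_pow_four_le s c
    _ = _ := by
        rw [ENNReal.ofReal_rpow_of_nonneg hm0 (by linarith),
          ENNReal.ofReal_rpow_of_nonneg (by positivity) (by linarith),
          ← ENNReal.ofReal_mul (by positivity), Real.mul_rpow (by positivity) (by positivity),
          ← Real.rpow_natCast, ← Real.rpow_mul hm0, ← mul_assoc,
          ← Real.rpow_add_of_nonneg hm0 (by linarith) (by push_cast; linarith)]
        congr 4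
        push_cast
        ring

theorem sum_integral_eigenfun_pow_four_le (N : ℕ) :
    ∑ j ∈ Finset.range (N + 1), ∫ x : Plane, eigenfun j x ^ 4 ≤ 2 * massMean N ^ 2 := by
  have hmono : ∀ j ≤ N, massMean j ≤ massMean N := by
    intro j hj
    exact Finset.sum_le_sum_of_subset_of_nonneg
      (Finset.range_mono (by omega)) fun i _ _ => by positivity
  have hpi := Real.pi_gt_three
  have h1 : ∑ j ∈ Finset.range (N + 1), ∫ x : Plane, eigenfun j x ^ 4 ≤
      ∑ j ∈ Finset.range (N + 1), 2 * massMean N * (1 / (4 * (j : ℝ) + 2)) := by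
    refine Finset.sum_le_sum fun j hj => ?_
    have hj' : j ≤ N := by have := Finset.mem_range.1 hj; omega
    refine (integral_eigenfun_pow_four_le j).trans ?_
    have h0 := massMean_nonneg j
    rw [mul_one_div, div_le_div_iff₀ (by positivity) (by positivity)]
    have h2 := hmono j hj'
    have hj0 : (0 : ℝ) ≤ j := by positivity
    calc massMean j * (4 * j + 2) ≤ massMean N * (4 * j + 2) := by gcongr
      _ ≤ massMean N * (2 * (Real.pi * (j + 1))) := by
          have := h0.trans h2
          gcongr
          nlinarith
      _ = _ := by ring
  refine h1.trans (le_of_eq ?_)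
  rw [← Finset.mul_sum, ← massMean]
  ring

/-- The covariance `∑_{j ∈ s} e_j(x)² / (4j+2)` of a block of the Gaussian series. -/
def blockVariance (s : Finset ℕ) (x : Plane) : ℝ :=
  ∑ j ∈ s, 1 / (4 * (j : ℝ) + 2) * eigenfun j x ^ 2

theorem blockVariance_nonneg (s : Finset ℕ) (x : Plane) : 0 ≤ blockVariance s x := by
  unfold blockVariance; positivity

theorem continuous_blockVariance (s : Finset ℕ) : Continuous (blockVariance s) :=
  continuous_finsetSum _ fun j _ => continuous_const.mul ((continuous_eigenfun j).pow 2)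

theorem lintegral_blockVariance_rpow_le_sum {q : ℝ} (hq2 : 2 ≤ q) (hq4 : q ≤ 4) (s : Finset ℕ) :
    ∫⁻ x, ENNReal.ofReal (blockVariance s x ^ (q / 2)) ≤ ENNReal.ofReal ((∑ j ∈ s,
      1 / (4 * (j : ℝ) + 2) * (∫ x : Plane, eigenfun j x ^ 4) ^ (1 - 2 / q)) ^ (q / 2)) := by
  have hq0 : 0 < q := by linarith
  have hj : ∀ j : ℕ, eLpNorm' (fun x => 1 / (4 * (j : ℝ) + 2) * eigenfun j x ^ 2) (q / 2) volume ≤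
      ENNReal.ofReal (1 / (4 * (j : ℝ) + 2) * (∫ x : Plane, eigenfun j x ^ 4) ^ (1 - 2 / q)) := by
    intro j
    have h1 := lintegral_enorm_radialSum_rpow_le hq2 hq4 {j} (fun _ => 1)
    simp only [radialSum, Finset.sum_singleton, one_mul, norm_one, one_pow, Real.one_rpow,
      Finset.card_singleton, Nat.cast_one] at h1
    have h2 : eLpNorm' (fun x => eigenfun j x ^ 2) (q / 2) volume ≤
        ENNReal.ofReal ((∫ x : Plane, eigenfun j x ^ 4) ^ (1 - 2 / q)) := by
      rw [eLpNorm']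
      have e : ∀ x, ‖eigenfun j x ^ 2‖ₑ ^ (q / 2) = ‖(eigenfun j x : ℂ)‖ₑ ^ q := by
        intro x
        have : ‖(eigenfun j x : ℂ)‖ₑ = ‖eigenfun j x‖ₑ := by
          rw [← ofReal_norm, Complex.norm_real, ofReal_norm]
        rw [this, enorm_pow, ← ENNReal.rpow_natCast, ← ENNReal.rpow_mul]
        congr 1
        push_cast
        ring
      simp_rw [e]
      calc _ ≤ (ENNReal.ofReal ((∫ x : Plane, eigenfun j x ^ 4) ^ ((q - 2) / 2))) ^
            (1 / (q / 2)) := by gcongr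
        _ = _ := by
            have h0 := integral_eigenfun_pow_four_nonneg j
            rw [ENNReal.ofReal_rpow_of_nonneg (by positivity) (by positivity),
              ← Real.rpow_mul h0]
            congr 2
            field_simp
    have h3 : (fun x => 1 / (4 * (j : ℝ) + 2) * eigenfun j x ^ 2) =
        (1 / (4 * (j : ℝ) + 2)) • fun x => eigenfun j x ^ 2 := rfl
    rw [h3, eLpNorm'_const_smul _ (by positivity), ENNReal.ofReal_mul (by positivity)]
    gcongr
    rw [Real.enorm_eq_ofReal (by positivity)]
  have h := eLpNorm'_sum_le (μ := (volume : Measure Plane)) (s := s) (q := q / 2)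
    (f := fun (j : ℕ) x => 1 / (4 * (j : ℝ) + 2) * eigenfun j x ^ 2)
    (fun j _ => (continuous_const.mul ((continuous_eigenfun j).pow 2)).aestronglyMeasurable)
    (by linarith)
  have h' := h.trans (Finset.sum_le_sum fun j _ => hj j)
  have hnn : ∀ j : ℕ, 0 ≤ 1 / (4 * (j : ℝ) + 2) * (∫ x : Plane, eigenfun j x ^ 4) ^ (1 - 2 / q) :=
    fun j => mul_nonneg (by positivity) (Real.rpow_nonneg (integral_eigenfun_pow_four_nonneg j) _)
  rw [← ENNReal.ofReal_sum_of_nonneg fun j _ => hnn j] at h'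
  have e : ∀ x, (∑ j ∈ s, fun (x : Plane) => 1 / (4 * (j : ℝ) + 2) * eigenfun j x ^ 2) x =
      blockVariance s x := by
    intro x; simp [blockVariance]
  rw [eLpNorm'] at h'
  simp_rw [e] at h'
  have e2 : ∀ x, ‖blockVariance s x‖ₑ ^ (q / 2) = ENNReal.ofReal (blockVariance s x ^ (q / 2)) := by
    intro x
    rw [Real.enorm_eq_ofReal (blockVariance_nonneg s x),
      ENNReal.ofReal_rpow_of_nonneg (blockVariance_nonneg s x) (by positivity)]
  simp_rw [e2] at h'
  calc _ = ((∫⁻ x, ENNReal.ofReal (blockVariance s x ^ (q / 2))) ^ (1 / (q / 2))) ^ (q / 2) := by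
        rw [← ENNReal.rpow_mul, one_div, inv_mul_cancel₀ (by positivity), ENNReal.rpow_one]
    _ ≤ _ := by
        rw [← ENNReal.ofReal_rpow_of_nonneg (Finset.sum_nonneg fun j _ => hnn j) (by positivity)]
        gcongr

/-- The tail of the covariance decays like `N^{-κ}` in `L^{q/2}`, for every `κ < 1 - 2/q`. -/
theorem exists_lintegral_blockVariance_rpow_le {q κ : ℝ} (hq2 : 2 < q) (hq4 : q ≤ 4)
    (hκ0 : 0 ≤ κ) (hκ : κ < 1 - 2 / q) :
    ∃ C : ℝ, 0 < C ∧ ∀ (N : ℕ) (s : Finset ℕ), (∀ j ∈ s, N ≤ j) →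
      ∫⁻ x, ENNReal.ofReal (blockVariance s x ^ (q / 2)) ≤
        ENNReal.ofReal ((C * ((N : ℝ) + 1) ^ (-κ)) ^ (q / 2)) := by
  set θ := 1 - 2 / q with hθ
  have hq0 : 0 < q := by linarith
  have hθ1 : θ ≤ 1 := by rw [hθ]; have : 0 < 2 / q := by positivity
                         linarith
  set ε := (θ - κ) / 2 with hε
  have hε0 : 0 < ε := by rw [hε]; linarith
  set K := 1 + 1 / ε with hK
  have hK0 : 0 < K := by positivity
  have hsum : Summable fun j : ℕ => ((j : ℝ) + 1) ^ (-1 - ε) := by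
    have h := (summable_nat_add_iff 1).2 (Real.summable_nat_rpow.2 (show -1 - ε < -1 by linarith))
    simpa using h
  set Z := ∑' j : ℕ, ((j : ℝ) + 1) ^ (-1 - ε) with hZ
  have hZ0 : 0 ≤ Z := tsum_nonneg fun j => by positivity
  refine ⟨K ^ θ * (Z + 1), by positivity, fun N s hs => ?_⟩
  refine (lintegral_blockVariance_rpow_le_sum hq2.le hq4 s).trans ?_
  apply ENNReal.ofReal_le_ofReal
  apply Real.rpow_le_rpow
  · exact Finset.sum_nonneg fun j _ => mul_nonneg (by positivity)
      (Real.rpow_nonneg (integral_eigenfun_pow_four_nonneg j) _)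
  · have hterm : ∀ j ∈ s, 1 / (4 * (j : ℝ) + 2) * (∫ x : Plane, eigenfun j x ^ 4) ^ θ ≤
        K ^ θ * ((N : ℝ) + 1) ^ (-κ) * ((j : ℝ) + 1) ^ (-1 - ε) := by
      intro j hj
      have hNj : ((N : ℝ) + 1) ≤ (j : ℝ) + 1 := by
        have : (N : ℝ) ≤ j := by exact_mod_cast hs j hj
        linarith
      have hj1 : (1 : ℝ) ≤ (j : ℝ) + 1 := by simp
      have hj0 : (0 : ℝ) < (j : ℝ) + 1 := by positivity
      have h1 : ∫ x : Plane, eigenfun j x ^ 4 ≤ K * ((j : ℝ) + 1) ^ (ε - 1) := by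
        refine (integral_eigenfun_pow_four_le j).trans ?_
        have hpi := Real.pi_gt_three
        have h2 := massMean_le_rpow hε0 j
        rw [Real.rpow_sub hj0, Real.rpow_one, ← mul_div_assoc]
        have h3 := massMean_nonneg j
        calc _ ≤ massMean j / ((j : ℝ) + 1) := by
              gcongr
              nlinarith
          _ ≤ _ := by gcongr
      have h2 : (∫ x : Plane, eigenfun j x ^ 4) ^ θ ≤ K ^ θ * ((j : ℝ) + 1) ^ (-κ - ε) := by
        calc _ ≤ (K * ((j : ℝ) + 1) ^ (ε - 1)) ^ θ :=
              Real.rpow_le_rpow (integral_eigenfun_pow_four_nonneg j) h1 (by linarith)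
          _ = K ^ θ * ((j : ℝ) + 1) ^ ((ε - 1) * θ) := by
              rw [Real.mul_rpow hK0.le (by positivity), ← Real.rpow_mul hj0.le]
          _ ≤ _ := by
              gcongr K ^ θ * ?_
              apply Real.rpow_le_rpow_of_exponent_le hj1
              have : κ = θ - 2 * ε := by rw [hε]; ring
              nlinarith
      calc _ ≤ (((j : ℝ) + 1) ^ (-1 : ℝ)) * (K ^ θ * ((j : ℝ) + 1) ^ (-κ - ε)) := by
            apply mul_le_mul _ h2 (Real.rpow_nonneg (integral_eigenfun_pow_four_nonneg j) _)
              (by positivity)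
            rw [Real.rpow_neg_one, one_div]
            apply inv_anti₀ hj0
            linarith
        _ = K ^ θ * ((j : ℝ) + 1) ^ (-κ) * ((j : ℝ) + 1) ^ (-1 - ε) := by
            rw [mul_left_comm, mul_assoc, ← Real.rpow_add hj0, ← Real.rpow_add hj0]
            ring_nf
        _ ≤ _ := by
            have h3 : ((j : ℝ) + 1) ^ (-κ) ≤ ((N : ℝ) + 1) ^ (-κ) :=
              Real.rpow_le_rpow_of_nonpos (by positivity) hNj (by linarith)
            gcongr
    calc _ ≤ ∑ j ∈ s, K ^ θ * ((N : ℝ) + 1) ^ (-κ) * ((j : ℝ) + 1) ^ (-1 - ε) :=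
          Finset.sum_le_sum hterm
      _ = K ^ θ * ((N : ℝ) + 1) ^ (-κ) * ∑ j ∈ s, ((j : ℝ) + 1) ^ (-1 - ε) := by
          rw [Finset.mul_sum]
      _ ≤ K ^ θ * ((N : ℝ) + 1) ^ (-κ) * (Z + 1) := by
          gcongr
          have := hsum.sum_le_tsum s (fun j _ => by positivity)
          linarith
      _ = _ := by ring
  · positivity

/-! ### Exponential moments of complex Gaussians -/

theorem integral_gaussian_exp_inner {b : ℝ} (hb : 0 < b) (w : ℂ) :
    ∫ z : ℂ, Real.exp (-b * ‖z‖ ^ 2 + inner ℝ w z) =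
      Real.pi / b * Real.exp (‖w‖ ^ 2 / (4 * b)) := by
  have h := GaussianFourier.integral_cexp_neg_mul_sq_norm_add (V := ℂ) (b := (b : ℂ))
    (by simpa using hb) 1 w
  rw [Complex.finrank_real_complex] at h
  have e : ∀ z : ℂ, Complex.exp (-(b : ℂ) * (‖z‖ : ℂ) ^ 2 + 1 * ((inner ℝ w z : ℝ) : ℂ)) =
      ((Real.exp (-b * ‖z‖ ^ 2 + inner ℝ w z) : ℝ) : ℂ) := by
    intro z; push_cast; simp
  have h' : ((∫ z : ℂ, Real.exp (-b * ‖z‖ ^ 2 + inner ℝ w z) : ℝ) : ℂ) =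
      ((Real.pi / b * Real.exp (‖w‖ ^ 2 / (4 * b)) : ℝ) : ℂ) := by
    rw [← integral_complex_ofReal]
    simp_rw [← e]
    refine Eq.trans h ?_
    push_cast
    norm_num
  exact_mod_cast h'

theorem lintegral_gaussian_exp_inner {b : ℝ} (hb : 0 < b) (w : ℂ) :
    ∫⁻ z : ℂ, ENNReal.ofReal (Real.exp (-b * ‖z‖ ^ 2 + inner ℝ w z)) =
      ENNReal.ofReal (Real.pi / b * Real.exp (‖w‖ ^ 2 / (4 * b))) := by
  rw [← integral_gaussian_exp_inner hb w, ofReal_integral_eq_lintegral_ofReal _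
    (ae_of_all _ fun z => (Real.exp_pos _).le)]
  apply Integrable.of_integral_ne_zero
  rw [integral_gaussian_exp_inner hb w]
  have := Real.pi_pos
  positivity

theorem lintegral_stdComplexGaussian_exp {s : ℝ} (hs : s < 1) (w : ℂ) :
    ∫⁻ z, ENNReal.ofReal (Real.exp (s * ‖z‖ ^ 2 + inner ℝ w z)) ∂stdComplexGaussian =
      ENNReal.ofReal (1 / (1 - s) * Real.exp (‖w‖ ^ 2 / (4 * (1 - s)))) := by
  have hpi := Real.pi_pos
  rw [stdComplexGaussian, lintegral_withDensity_eq_lintegral_mul _ (by fun_prop) (by fun_prop)]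
  have e : ∀ z : ℂ, ((fun z : ℂ => ENNReal.ofReal (Real.exp (-(‖z‖ ^ 2)) / Real.pi)) *
      fun z => ENNReal.ofReal (Real.exp (s * ‖z‖ ^ 2 + inner ℝ w z))) z =
      ENNReal.ofReal (1 / Real.pi) *
        ENNReal.ofReal (Real.exp (-(1 - s) * ‖z‖ ^ 2 + inner ℝ w z)) := by
    intro z
    rw [Pi.mul_apply, ← ENNReal.ofReal_mul (by positivity), ← ENNReal.ofReal_mul (by positivity)]
    congr 1
    rw [div_mul_eq_mul_div, ← Real.exp_add, one_div, inv_mul_eq_div]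
    ring_nf
  simp_rw [e]
  rw [lintegral_const_mul _ (by fun_prop), lintegral_gaussian_exp_inner (by linarith),
    ← ENNReal.ofReal_mul (by positivity)]
  congr 1
  field_simp

/-- A sequence of independent normalized complex Gaussian variables. -/
structure IsGaussianSequence {Ω : Type*} [MeasurableSpace Ω] (P : Measure Ω)
    (g : ℕ → Ω → ℂ) : Prop where
  measurable : ∀ k, Measurable (g k)
  law : ∀ k, P.map (g k) = stdComplexGaussian
  indep : iIndepFun g P

/-- The coefficients `g_j / √(4j+2)` of the Gaussian series. -/
def gaussianCoeff {Ω : Type*} (g : ℕ → Ω → ℂ) (ω : Ω) (j : ℕ) : ℂ :=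
  g j ω / (Real.sqrt (4 * (j : ℝ) + 2) : ℂ)

theorem norm_gaussianCoeff_sq {Ω : Type*} (g : ℕ → Ω → ℂ) (ω : Ω) (j : ℕ) :
    ‖gaussianCoeff g ω j‖ ^ 2 = ‖g j ω‖ ^ 2 / (4 * (j : ℝ) + 2) := by
  rw [gaussianCoeff, norm_div, div_pow, Complex.norm_real, Real.norm_eq_abs, sq_abs,
    Real.sq_sqrt (by positivity)]

section

variable {Ω : Type*} [MeasurableSpace Ω] {P : Measure Ω} {g : ℕ → Ω → ℂ}

theorem IsGaussianSequence.lintegral_exp (hg : IsGaussianSequence P g) (k : ℕ) {s : ℝ} (hs : s < 1)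
    (w : ℂ) :
    ∫⁻ ω, ENNReal.ofReal (Real.exp (s * ‖g k ω‖ ^ 2 + inner ℝ w (g k ω))) ∂P =
      ENNReal.ofReal (1 / (1 - s) * Real.exp (‖w‖ ^ 2 / (4 * (1 - s)))) := by
  rw [← lintegral_stdComplexGaussian_exp hs w, ← hg.law k,
    lintegral_map (by fun_prop) (hg.measurable k)]

theorem IsGaussianSequence.lintegral_prod (hg : IsGaussianSequence P g) (s : Finset ℕ)
    (F : ℕ → ℂ → ℝ≥0∞) (hF : ∀ k, Measurable (F k)) :
    ∫⁻ ω, ∏ k ∈ s, F k (g k ω) ∂P = ∏ k ∈ s, ∫⁻ ω, F k (g k ω) ∂P :=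
  lintegral_prod_eq_prod_lintegral_of_indepFun s (fun k ω => F k (g k ω))
    (hg.indep.comp F hF) fun k => (hF k).comp (hg.measurable k)

/-- A real linear combination `Z` of independent Gaussians with total variance at most one satisfies
`E exp(|Z|²/4) ≤ 4/3`. The square is linearized by writing `exp(|Z|²/4)` as the Gaussian average
of `exp⟨Z, w⟩` over `w`. -/
theorem IsGaussianSequence.lintegral_exp_sq_le (hg : IsGaussianSequence P g) [SFinite P]
    (s : Finset ℕ) (β : ℕ → ℝ) (hβ : ∑ j ∈ s, β j ^ 2 ≤ 1) :
    ∫⁻ ω, ENNReal.ofReal (Real.exp (‖∑ j ∈ s, (β j : ℂ) * g j ω‖ ^ 2 / 4)) ∂P ≤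
      ENNReal.ofReal (4 / 3) := by
  have hpi := Real.pi_pos
  have hZ : Measurable fun ω => ∑ j ∈ s, (β j : ℂ) * g j ω :=
    Finset.measurable_sum s fun j _ => (hg.measurable j).const_mul _
  have h1 : ∀ z : ℂ, ENNReal.ofReal (Real.exp (‖z‖ ^ 2 / 4)) =
      ∫⁻ w : ℂ, ENNReal.ofReal (1 / Real.pi * Real.exp (-‖w‖ ^ 2)) *
        ENNReal.ofReal (Real.exp (inner ℝ z w)) := by
    intro z
    have h := lintegral_gaussian_exp_inner one_pos z
    have e : ∀ w : ℂ, ENNReal.ofReal (1 / Real.pi * Real.exp (-‖w‖ ^ 2)) *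
        ENNReal.ofReal (Real.exp (inner ℝ z w)) = ENNReal.ofReal (1 / Real.pi) *
        ENNReal.ofReal (Real.exp (-1 * ‖w‖ ^ 2 + inner ℝ z w)) := by
      intro w
      rw [← ENNReal.ofReal_mul (by positivity), ← ENNReal.ofReal_mul (by positivity), mul_assoc,
        ← Real.exp_add, neg_one_mul]
    simp_rw [e]
    rw [lintegral_const_mul _ (by fun_prop), h, ← ENNReal.ofReal_mul (by positivity)]
    congr 1
    field_simp
  simp_rw [h1]
  rw [lintegral_lintegral_swap]
  · have h2 : ∀ w : ℂ, ∫⁻ ω, ENNReal.ofReal (1 / Real.pi * Real.exp (-‖w‖ ^ 2)) *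
        ENNReal.ofReal (Real.exp (inner ℝ (∑ j ∈ s, (β j : ℂ) * g j ω) w)) ∂P ≤
        ENNReal.ofReal (1 / Real.pi) *
          ENNReal.ofReal (Real.exp (-(3 / 4) * ‖w‖ ^ 2 + inner ℝ (0 : ℂ) w)) := by
      intro w
      have e : ∀ ω, ENNReal.ofReal (Real.exp (inner ℝ (∑ j ∈ s, (β j : ℂ) * g j ω) w)) =
          ∏ j ∈ s, ENNReal.ofReal (Real.exp (0 * ‖g j ω‖ ^ 2 + inner ℝ ((β j : ℂ) * w) (g j ω))) := by
        intro ω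
        rw [sum_inner, Real.exp_sum, ENNReal.ofReal_prod_of_nonneg fun j _ => (Real.exp_pos _).le]
        refine Finset.prod_congr rfl fun j _ => ?_
        rw [zero_mul, zero_add, real_inner_comm]
        congr 2
        rw [← Complex.real_smul, ← Complex.real_smul, inner_smul_left, inner_smul_right]
        simp
      simp_rw [e]
      rw [lintegral_const_mul, hg.lintegral_prod s
        (fun j z => ENNReal.ofReal (Real.exp (0 * ‖z‖ ^ 2 + inner ℝ ((β j : ℂ) * w) z)))
        (fun j => by fun_prop)]
      · simp_rw [hg.lintegral_exp _ zero_lt_one]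
        rw [← ENNReal.ofReal_prod_of_nonneg fun j _ => by positivity,
          ← ENNReal.ofReal_mul (by positivity), ← ENNReal.ofReal_mul (by positivity)]
        apply ENNReal.ofReal_le_ofReal
        rw [mul_assoc]
        gcongr
        have e2 : ∏ j ∈ s, (1 / (1 - 0) * Real.exp (‖(β j : ℂ) * w‖ ^ 2 / (4 * (1 - 0)))) =
            Real.exp ((∑ j ∈ s, β j ^ 2) * ‖w‖ ^ 2 / 4) := by
          rw [Finset.sum_mul, Finset.sum_div, Real.exp_sum]
          refine Finset.prod_congr rfl fun j _ => ?_
          rw [norm_mul, Complex.norm_real, mul_pow, Real.norm_eq_abs, sq_abs]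
          norm_num
        rw [e2, ← Real.exp_add, inner_zero_left, add_zero]
        apply Real.exp_le_exp.2
        nlinarith [sq_nonneg ‖w‖]
      · refine Finset.measurable_prod s fun j _ => ?_
        have := hg.measurable j
        fun_prop
    refine (lintegral_mono h2).trans ?_
    rw [lintegral_const_mul _ (by fun_prop), lintegral_gaussian_exp_inner (by norm_num),
      ← ENNReal.ofReal_mul (by positivity)]
    apply ENNReal.ofReal_le_ofReal
    apply le_of_eq
    field_simp
    simp
  · apply Measurable.aemeasurable
    have := hZ.comp (measurable_fst : Measurable (Prod.fst : Ω × ℂ → Ω))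
    simp only [Function.uncurry_def]
    fun_prop

theorem one_div_one_sub_mul_exp_neg_le {s : ℝ} (hs : |s| ≤ 1 / 2) :
    1 / (1 - s) * Real.exp (-s) ≤ Real.exp (s ^ 2) := by
  obtain ⟨h1, h2⟩ := abs_le.1 hs
  have h3 : 0 < 1 - s := by linarith
  have key : 1 ≤ (1 - s) * Real.exp (s + s ^ 2) := by
    rcases le_total 0 s with h | h
    · have := Real.quadratic_le_exp_of_nonneg (show 0 ≤ s + s ^ 2 by positivity)
      calc (1 : ℝ) ≤ (1 - s) * (1 + (s + s ^ 2) + (s + s ^ 2) ^ 2 / 2) := by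
            have : 0 ≤ (1 - s) * (1 + s) ^ 2 - 2 * s := by nlinarith
            nlinarith [mul_nonneg (sq_nonneg s) this]
        _ ≤ _ := by gcongr
    · have := Real.add_one_le_exp (s + s ^ 2)
      calc (1 : ℝ) ≤ (1 - s) * (s + s ^ 2 + 1) := by nlinarith [sq_nonneg s]
        _ ≤ _ := by gcongr
  rw [one_div, inv_mul_le_iff₀ h3]
  have e : Real.exp (s + s ^ 2) = Real.exp s * Real.exp (s ^ 2) := Real.exp_add _ _
  rw [e] at key
  rw [Real.exp_neg, inv_le_iff_one_le_mul₀ (Real.exp_pos _)]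
  linarith

/-- Exponential moments of a block of the renormalized mass, from
`E exp(s(|g|² - 1)) = e^{-s} / (1 - s) ≤ e^{s²}` for `|s| ≤ 1/2`. -/
theorem IsGaussianSequence.lintegral_exp_sum_le (hg : IsGaussianSequence P g) (s : Finset ℕ)
    (t : ℝ) (ht : ∀ j ∈ s, |t| ≤ 2 * (j : ℝ) + 1) :
    ∫⁻ ω, ENNReal.ofReal (Real.exp (t * ∑ j ∈ s, (‖g j ω‖ ^ 2 - 1) / (4 * (j : ℝ) + 2))) ∂P ≤
      ENNReal.ofReal (Real.exp (t ^ 2 * ∑ j ∈ s, 1 / (4 * (j : ℝ) + 2) ^ 2)) := by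
  have e : ∀ ω, ENNReal.ofReal (Real.exp (t * ∑ j ∈ s, (‖g j ω‖ ^ 2 - 1) / (4 * (j : ℝ) + 2))) =
      ∏ j ∈ s, (ENNReal.ofReal (Real.exp (-(t / (4 * (j : ℝ) + 2)))) * ENNReal.ofReal
        (Real.exp ((t / (4 * (j : ℝ) + 2)) * ‖g j ω‖ ^ 2 + inner ℝ (0 : ℂ) (g j ω)))) := by
    intro ω
    rw [Finset.mul_sum, Real.exp_sum, ENNReal.ofReal_prod_of_nonneg fun j _ => (Real.exp_pos _).le]
    refine Finset.prod_congr rfl fun j _ => ?_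
    rw [← ENNReal.ofReal_mul (Real.exp_pos _).le, ← Real.exp_add, inner_zero_left]
    congr 2
    ring
  simp_rw [e]
  rw [hg.lintegral_prod s (fun (j : ℕ) z => ENNReal.ofReal (Real.exp (-(t / (4 * (j : ℝ) + 2)))) *
      ENNReal.ofReal (Real.exp ((t / (4 * (j : ℝ) + 2)) * ‖z‖ ^ 2 + inner ℝ (0 : ℂ) z)))
      (fun j => by fun_prop), Finset.mul_sum, Real.exp_sum,
      ENNReal.ofReal_prod_of_nonneg fun j _ => (Real.exp_pos _).le]
  refine Finset.prod_le_prod' fun j hj => ?_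
  have hj0 : (0 : ℝ) < 4 * j + 2 := by positivity
  have hs : |t / (4 * (j : ℝ) + 2)| ≤ 1 / 2 := by
    rw [abs_div, abs_of_pos hj0, div_le_div_iff₀ hj0 two_pos]
    have := ht j hj
    linarith
  have hs1 : t / (4 * (j : ℝ) + 2) < 1 := by
    have := (abs_le.1 hs).2
    linarith
  have hm := hg.measurable j
  rw [lintegral_const_mul _ (by fun_prop), hg.lintegral_exp j hs1, norm_zero,
    ← ENNReal.ofReal_mul (Real.exp_pos _).le]
  apply ENNReal.ofReal_le_ofReal
  have := one_div_one_sub_mul_exp_neg_le hs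
  rw [div_pow] at this
  rw [mul_one_div]
  calc _ = 1 / (1 - t / (4 * (j : ℝ) + 2)) * Real.exp (-(t / (4 * (j : ℝ) + 2))) := by
        simp [mul_comm]
    _ ≤ _ := this

theorem sum_Ico_one_div_sq_le (N n : ℕ) :
    ∑ j ∈ Finset.Ico N n, 1 / (4 * (j : ℝ) + 2) ^ 2 ≤ 1 / (2 * ((N : ℝ) + 1)) := by
  rcases le_total n N with h | h
  · rw [Finset.Ico_eq_empty_of_le h, Finset.sum_empty]; positivity
  · have key : ∑ j ∈ Finset.Ico N n, 1 / (4 * (j : ℝ) + 2) ^ 2 ≤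
        1 / (2 * ((N : ℝ) + 1)) - 1 / (2 * ((n : ℝ) + 1)) := by
      induction n, h using Nat.le_induction with
      | base => simp
      | succ n hn ih =>
        rw [Finset.sum_Ico_succ_top hn]
        have : 1 / (4 * (n : ℝ) + 2) ^ 2 ≤
            1 / (2 * ((n : ℝ) + 1)) - 1 / (2 * (((n + 1 : ℕ) : ℝ) + 1)) := by
          have hn0 : (0 : ℝ) ≤ n := by positivity
          push_cast
          rw [div_sub_div _ _ (by positivity) (by positivity),
            div_le_div_iff₀ (by positivity) (by positivity)]
          nlinarith [mul_nonneg hn0 hn0]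
        linarith
    have : (0 : ℝ) ≤ 1 / (2 * ((n : ℝ) + 1)) := by positivity
    linarith

/-- The lower tail of the block `∑_{N ≤ j < n} (|g_j|² - 1) / (4j+2)` of the renormalized mass. -/
theorem IsGaussianSequence.measure_mass_block_le (hg : IsGaussianSequence P g) (N n : ℕ) :
    P {ω | ∑ j ∈ Finset.Ico N n, (‖g j ω‖ ^ 2 - 1) / (4 * (j : ℝ) + 2) ≤ -1} ≤
      ENNReal.ofReal (Real.exp (-(((N : ℝ) + 1) / 2))) := by
  have hN : (0 : ℝ) < (N : ℝ) + 1 := by positivity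
  have h1 := hg.lintegral_exp_sum_le (Finset.Ico N n) (-((N : ℝ) + 1)) (by
    intro j hj
    have : (N : ℝ) ≤ j := by exact_mod_cast (Finset.mem_Ico.1 hj).1
    rw [abs_neg, abs_of_pos hN]
    have : (0 : ℝ) ≤ N := by positivity
    linarith)
  have hm : Measurable fun ω => ∑ j ∈ Finset.Ico N n, (‖g j ω‖ ^ 2 - 1) / (4 * (j : ℝ) + 2) :=
    Finset.measurable_sum _ fun j _ => by have := hg.measurable j; fun_prop
  have h2 : P {ω | ∑ j ∈ Finset.Ico N n, (‖g j ω‖ ^ 2 - 1) / (4 * (j : ℝ) + 2) ≤ -1} ≤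
      P {ω | ENNReal.ofReal (Real.exp ((N : ℝ) + 1)) ≤ ENNReal.ofReal (Real.exp
        (-((N : ℝ) + 1) * ∑ j ∈ Finset.Ico N n, (‖g j ω‖ ^ 2 - 1) / (4 * (j : ℝ) + 2)))} := by
    refine measure_mono fun ω hω => ?_
    simp only [Set.mem_ofPred_eq] at hω ⊢
    apply ENNReal.ofReal_le_ofReal
    apply Real.exp_le_exp.2
    nlinarith
  refine h2.trans ?_
  have h3 := meas_ge_le_lintegral_div (μ := P) (f := fun ω => ENNReal.ofReal (Real.exp
        (-((N : ℝ) + 1) * ∑ j ∈ Finset.Ico N n, (‖g j ω‖ ^ 2 - 1) / (4 * (j : ℝ) + 2))))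
    (ε := ENNReal.ofReal (Real.exp ((N : ℝ) + 1)))
    (hm.const_mul _).exp.ennreal_ofReal.aemeasurable
    (by simpa using Real.exp_pos _) ENNReal.ofReal_ne_top
  refine h3.trans ?_
  rw [ENNReal.div_le_iff (by simpa using Real.exp_pos _) ENNReal.ofReal_ne_top,
    ← ENNReal.ofReal_mul (Real.exp_pos _).le, ← Real.exp_add]
  refine h1.trans (ENNReal.ofReal_le_ofReal (Real.exp_le_exp.2 ?_))
  calc _ ≤ (-((N : ℝ) + 1)) ^ 2 * (1 / (2 * ((N : ℝ) + 1))) := by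
        gcongr; exact sum_Ico_one_div_sq_le N n
    _ = _ := by field_simp; ring

theorem IsGaussianSequence.lintegral_abs_mass_block_le (hg : IsGaussianSequence P g) (N n : ℕ) :
    ∫⁻ ω, ENNReal.ofReal |∑ j ∈ Finset.Ico N n, (‖g j ω‖ ^ 2 - 1) / (4 * (j : ℝ) + 2)| ∂P ≤
      ENNReal.ofReal (4 * ((N : ℝ) + 1) ^ (-(1 / 2) : ℝ)) := by
  set t : ℝ := ((N : ℝ) + 1) ^ (1 / 2 : ℝ) with ht
  have hN : (0 : ℝ) < (N : ℝ) + 1 := by positivity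
  have ht0 : 0 < t := by positivity
  have ht2 : t ^ 2 = (N : ℝ) + 1 := by
    rw [ht, ← Real.rpow_natCast, ← Real.rpow_mul hN.le]; norm_num
  have htN : t ≤ 2 * (N : ℝ) + 1 := by
    have : (0 : ℝ) ≤ N := by positivity
    nlinarith
  have hb : ∀ τ : ℝ, |τ| = t → ∫⁻ ω, ENNReal.ofReal (Real.exp
      (τ * ∑ j ∈ Finset.Ico N n, (‖g j ω‖ ^ 2 - 1) / (4 * (j : ℝ) + 2))) ∂P ≤
      ENNReal.ofReal 2 := by
    intro τ hτ
    refine (hg.lintegral_exp_sum_le (Finset.Ico N n) τ ?_).trans ?_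
    · intro j hj
      have : (N : ℝ) ≤ j := by exact_mod_cast (Finset.mem_Ico.1 hj).1
      rw [hτ]; linarith
    · apply ENNReal.ofReal_le_ofReal
      have e : τ ^ 2 = (N : ℝ) + 1 := by rw [← sq_abs, hτ, ht2]
      rw [e]
      calc _ ≤ Real.exp (((N : ℝ) + 1) * (1 / (2 * ((N : ℝ) + 1)))) := by
            gcongr; exact sum_Ico_one_div_sq_le N n
        _ = Real.exp (1 / 2) := by congr 1; field_simp
        _ ≤ 2 := by
            have h1 : Real.exp (1 / 2) ^ 2 = Real.exp 1 := by
              rw [← Real.exp_nat_mul]; norm_num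
            have h2 := Real.exp_one_lt_d9
            nlinarith [Real.exp_pos (1 / 2)]
  have hm : Measurable fun ω => ∑ j ∈ Finset.Ico N n, (‖g j ω‖ ^ 2 - 1) / (4 * (j : ℝ) + 2) :=
    Finset.measurable_sum _ fun j _ => by have := hg.measurable j; fun_prop
  have hpt : ∀ y : ℝ, ENNReal.ofReal |y| ≤ ENNReal.ofReal t⁻¹ *
      (ENNReal.ofReal (Real.exp (t * y)) + ENNReal.ofReal (Real.exp (-t * y))) := by
    intro y
    rw [← ENNReal.ofReal_add (Real.exp_pos _).le (Real.exp_pos _).le,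
      ← ENNReal.ofReal_mul (by positivity)]
    apply ENNReal.ofReal_le_ofReal
    rw [inv_mul_eq_div, le_div_iff₀ ht0]
    have h1 := Real.add_one_le_exp (t * y)
    have h2 := Real.add_one_le_exp (-t * y)
    have h3 := Real.exp_pos (t * y)
    have h4 := Real.exp_pos (-t * y)
    rcases abs_cases y with ⟨h, _⟩ | ⟨h, _⟩ <;> rw [h] <;> nlinarith
  refine (lintegral_mono fun ω => hpt _).trans ?_
  rw [lintegral_const_mul _ (by fun_prop), lintegral_add_left (by fun_prop)]
  calc _ ≤ ENNReal.ofReal t⁻¹ * (ENNReal.ofReal 2 + ENNReal.ofReal 2) := by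
        gcongr
        · exact hb t (abs_of_pos ht0)
        · exact hb (-t) (by rw [abs_neg, abs_of_pos ht0])
    _ = _ := by
        rw [← ENNReal.ofReal_add (by norm_num) (by norm_num), ← ENNReal.ofReal_mul (by positivity)]
        congr 1
        rw [Real.rpow_neg hN.le, ht]
        ring

/-! ### Gaussian concentration of Lebesgue norms -/

/-- The tangent line bound for the convex function `y ↦ exp(y^{1/a})` at `X^a`, `X ≥ 2`. -/
theorem exp_tangent_le {a X y : ℝ} (ha0 : 0 < a) (ha2 : a ≤ 2) (hX : 2 ≤ X) (hy : 0 ≤ y) :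
    Real.exp X * (X / a) * (y / X) ^ a ≤ Real.exp y + Real.exp X * (X / a - 1) := by
  have hX0 : 0 < X := by linarith
  have hb : (y / X) ^ a ≤ 1 + a / 2 * ((y / X) ^ 2 - 1) := by
    have h := rpow_one_add_le_one_add_mul_self (s := (y / X) ^ 2 - 1) (p := a / 2)
      (by nlinarith [sq_nonneg (y / X)]) (by linarith) (by linarith)
    have e : (1 + ((y / X) ^ 2 - 1)) ^ (a / 2) = (y / X) ^ a := by
      rw [add_sub_cancel, ← Real.rpow_natCast, ← Real.rpow_mul (by positivity)]
      congr 1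
      push_cast
      ring
    rwa [e] at h
  have hd : 1 + (y ^ 2 - X ^ 2) / (2 * X) ≤ Real.exp (y - X) := by
    set d := y - X with hd
    have e : (y ^ 2 - X ^ 2) / (2 * X) = d + d ^ 2 / (2 * X) := by
      rw [hd]; field_simp; ring
    rw [e]
    have h2 : d ^ 2 / (2 * X) ≤ d ^ 2 / 4 :=
      div_le_div_of_nonneg_left (sq_nonneg d) (by norm_num) (by linarith)
    rcases le_total 0 d with h | h
    · have := Real.quadratic_le_exp_of_nonneg h
      nlinarith [sq_nonneg d]
    · rcases le_total (-2) d with h' | h'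
      · have h3 := Real.add_one_le_exp (d / 2)
        have h4 : Real.exp d = Real.exp (d / 2) ^ 2 := by
          rw [← Real.exp_nat_mul]; push_cast; ring_nf
        rw [h4]
        nlinarith [Real.exp_pos (d / 2)]
      · have h3 : d ^ 2 / (2 * X) ≤ -d / 2 := by
          rw [div_le_iff₀ (by positivity)]
          have : -X ≤ d := by linarith
          nlinarith
        have := Real.exp_pos d
        linarith
  have hE := Real.exp_pos X
  have e2 : Real.exp y = Real.exp X * Real.exp (y - X) := by rw [← Real.exp_add]; ring_nf
  rw [e2]
  calc _ ≤ Real.exp X * (X / a) * (1 + a / 2 * ((y / X) ^ 2 - 1)) := by gcongr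
    _ = Real.exp X * (1 + (y ^ 2 - X ^ 2) / (2 * X)) + Real.exp X * (X / a - 1) := by
        field_simp; ring
    _ ≤ _ := by gcongr

/-- Jensen's inequality for `exp(‖Y‖_{L^a(ν)})`, `a ≤ 2`, up to an additive constant. -/
theorem exp_norm_le_lintegral_exp {α : Type*} [MeasurableSpace α] (ν : Measure α)
    (hν : ν Set.univ ≤ 1) {a : ℝ} (ha0 : 0 < a) (ha2 : a ≤ 2) {Y : α → ℝ} (hYm : Measurable Y)
    (hY : ∀ x, 0 ≤ Y x) {X : ℝ} (hX : ENNReal.ofReal (X ^ a) ≤ ∫⁻ x, ENNReal.ofReal (Y x ^ a) ∂ν) :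
    ENNReal.ofReal (Real.exp X) ≤
      ENNReal.ofReal (Real.exp 2) + ∫⁻ x, ENNReal.ofReal (Real.exp (Y x)) ∂ν := by
  rcases le_total X 2 with h | h
  · exact (ENNReal.ofReal_le_ofReal (Real.exp_le_exp.2 h)).trans le_self_add
  · have hX0 : 0 < X := by linarith
    have hXa : 0 ≤ X / a - 1 := by
      rw [sub_nonneg, le_div_iff₀ ha0]; linarith
    set c := Real.exp X * (X / a) * (X ^ a)⁻¹ with hc
    have hc0 : 0 ≤ c := by positivity
    have hd0 : 0 ≤ Real.exp X * (X / a - 1) := mul_nonneg (Real.exp_pos X).le hXa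
    have h1 : ∀ x, ENNReal.ofReal c * ENNReal.ofReal (Y x ^ a) ≤
        ENNReal.ofReal (Real.exp (Y x)) + ENNReal.ofReal (Real.exp X * (X / a - 1)) := by
      intro x
      rw [← ENNReal.ofReal_mul hc0, ← ENNReal.ofReal_add (Real.exp_pos _).le hd0]
      apply ENNReal.ofReal_le_ofReal
      have := exp_tangent_le ha0 ha2 h (hY x)
      rw [Real.div_rpow (hY x) hX0.le, div_eq_mul_inv (Y x ^ a)] at this
      rw [hc]
      linarith
    have h2 := lintegral_mono h1 (μ := ν)
    rw [lintegral_const_mul _ (by fun_prop), lintegral_add_left (by fun_prop),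
      lintegral_const] at h2
    have h3 : ENNReal.ofReal (Real.exp X) + ENNReal.ofReal (Real.exp X * (X / a - 1)) ≤
        ∫⁻ x, ENNReal.ofReal (Real.exp (Y x)) ∂ν + ENNReal.ofReal (Real.exp X * (X / a - 1)) := by
      calc _ = ENNReal.ofReal c * ENNReal.ofReal (X ^ a) := by
            rw [← ENNReal.ofReal_add (Real.exp_pos _).le hd0, ← ENNReal.ofReal_mul hc0]
            congr 1
            rw [hc, mul_assoc, inv_mul_cancel₀ (by positivity)]
            ring
        _ ≤ _ := (mul_le_mul_right hX _)
        _ ≤ _ := h2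
        _ ≤ _ := by
            gcongr
            exact mul_le_of_le_one_right' hν
    exact ((ENNReal.add_le_add_iff_right ENNReal.ofReal_ne_top).1 h3).trans le_add_self

theorem IsGaussianSequence.measurable_gaussianCoeff (hg : IsGaussianSequence P g) (j : ℕ) :
    Measurable fun ω => gaussianCoeff g ω j :=
  (hg.measurable j).div_const _

theorem IsGaussianSequence.measurable_radialSum (hg : IsGaussianSequence P g) (s : Finset ℕ) :
    Measurable fun z : Ω × Plane => radialSum s (gaussianCoeff g z.1) z.2 := by
  refine Finset.measurable_sum s fun j _ => ?_
  have h1 := (hg.measurable_gaussianCoeff j).comp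
    (measurable_fst : Measurable (Prod.fst : Ω × Plane → Ω))
  have h2 : Measurable fun z : Ω × Plane => ((eigenfun j z.2 : ℝ) : ℂ) :=
    Complex.measurable_ofReal.comp ((continuous_eigenfun j).measurable.comp measurable_snd)
  exact h1.mul h2

theorem radialSum_eq_zero_of_blockVariance_eq_zero {s : Finset ℕ} {x : Plane}
    (h : blockVariance s x = 0) (c : ℕ → ℂ) : radialSum s c x = 0 := by
  rw [blockVariance, Finset.sum_eq_zero_iff_of_nonneg fun j _ => by positivity] at h
  refine Finset.sum_eq_zero fun j hj => ?_
  have h1 := h j hj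
  have h2 : eigenfun j x = 0 := by
    rcases mul_eq_zero.1 h1 with h3 | h3
    · exact absurd h3 (by positivity)
    · exact pow_eq_zero_iff two_ne_zero |>.1 h3
  rw [h2]; simp

/-- At a fixed point, a block of the Gaussian series is a Gaussian of variance `blockVariance`. -/
theorem IsGaussianSequence.lintegral_exp_radialSum_le (hg : IsGaussianSequence P g)
    [IsProbabilityMeasure P] (s : Finset ℕ) (x : Plane) :
    ∫⁻ ω, ENNReal.ofReal (Real.exp (‖radialSum s (gaussianCoeff g ω) x‖ ^ 2 /
      (4 * blockVariance s x))) ∂P ≤ ENNReal.ofReal (4 / 3) := by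
  rcases (blockVariance_nonneg s x).eq_or_lt with h0 | h0
  · simp only [← h0, mul_zero, div_zero, Real.exp_zero, lintegral_const, measure_univ, mul_one]
    exact ENNReal.ofReal_le_ofReal (by norm_num)
  · set S := blockVariance s x with hS
    have h := hg.lintegral_exp_sq_le s
      (fun j => eigenfun j x / (Real.sqrt (4 * (j : ℝ) + 2) * Real.sqrt S)) (by
        apply le_of_eq
        have e : ∀ j ∈ s, (eigenfun j x / (Real.sqrt (4 * (j : ℝ) + 2) * Real.sqrt S)) ^ 2 =
            (1 / (4 * (j : ℝ) + 2) * eigenfun j x ^ 2) / S := by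
          intro j _
          rw [div_pow, mul_pow, Real.sq_sqrt (by positivity), Real.sq_sqrt h0.le]
          field_simp
        rw [Finset.sum_congr rfl e, ← Finset.sum_div]
        exact div_self h0.ne')
    refine le_trans (le_of_eq ?_) h
    refine lintegral_congr fun ω => ?_
    congr 2
    have e : radialSum s (gaussianCoeff g ω) x = (Real.sqrt S : ℂ) * ∑ j ∈ s,
        ((eigenfun j x / (Real.sqrt (4 * (j : ℝ) + 2) * Real.sqrt S) : ℝ) : ℂ) * g j ω := by
      rw [radialSum, Finset.mul_sum]
      refine Finset.sum_congr rfl fun j _ => ?_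
      have h1 : (Real.sqrt S : ℂ) ≠ 0 := by
        exact_mod_cast (Real.sqrt_pos.2 h0).ne'
      have h2 : (Real.sqrt (4 * (j : ℝ) + 2) : ℂ) ≠ 0 := by
        exact_mod_cast (Real.sqrt_pos.2 (by positivity : (0 : ℝ) < 4 * (j : ℝ) + 2)).ne'
      rw [gaussianCoeff]
      push_cast
      field_simp
    rw [e, norm_mul, Complex.norm_real, mul_pow, Real.norm_eq_abs, sq_abs, Real.sq_sqrt h0.le,
      mul_comm 4 S, mul_div_mul_left _ _ h0.ne']

/-- Gaussian concentration: a block of the Gaussian series has Gaussian moments in `L^q`, on the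
scale given by the `L^{q/2}` norm of its covariance. -/
theorem IsGaussianSequence.lintegral_exp_lqNorm_sq_le (hg : IsGaussianSequence P g)
    [IsProbabilityMeasure P] {q A : ℝ} (hq0 : 0 < q) (hq4 : q ≤ 4) (hA : 0 < A) (s : Finset ℕ)
    (hS : ∫⁻ x, ENNReal.ofReal (blockVariance s x ^ (q / 2)) ≤ ENNReal.ofReal (A ^ (q / 2))) :
    ∫⁻ ω, ENNReal.ofReal (Real.exp (lqNorm q (radialSum s (gaussianCoeff g ω)) ^ 2 / (4 * A))) ∂P ≤
      ENNReal.ofReal (Real.exp 2 + 4 / 3) := by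
  -- `ν` has density `(S/A)^{q/2}`, so that `‖v‖_q² / (4A)` is the `L^{q/2}(ν)` norm of `|v|² / (4S)`,
  -- whose exponential moments are bounded pointwise; here `S` is the block variance
  set W : Plane → ℝ≥0∞ := fun x => ENNReal.ofReal ((blockVariance s x / A) ^ (q / 2)) with hW
  have hcont := (continuous_blockVariance s).measurable
  have hWm : Measurable W := by
    simp only [hW]; fun_prop
  set ν : Measure Plane := volume.withDensity W with hν
  have hν1 : ν Set.univ ≤ 1 := by
    rw [hν, withDensity_apply _ MeasurableSet.univ, Measure.restrict_univ]
    have e : ∀ x, W x = ENNReal.ofReal ((A ^ (q / 2))⁻¹) *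
        ENNReal.ofReal (blockVariance s x ^ (q / 2)) := by
      intro x
      rw [hW, ← ENNReal.ofReal_mul (by positivity)]
      simp only
      rw [Real.div_rpow (blockVariance_nonneg s x) hA.le, inv_mul_eq_div]
    simp_rw [e]
    rw [lintegral_const_mul _ (by fun_prop)]
    calc _ ≤ ENNReal.ofReal ((A ^ (q / 2))⁻¹) * ENNReal.ofReal (A ^ (q / 2)) := by gcongr
      _ = 1 := by
          rw [← ENNReal.ofReal_mul (by positivity), inv_mul_cancel₀ (by positivity),
            ENNReal.ofReal_one]
  have : IsFiniteMeasure ν := ⟨hν1.trans_lt ENNReal.one_lt_top⟩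
  have hpt : ∀ ω, ENNReal.ofReal (Real.exp
      (lqNorm q (radialSum s (gaussianCoeff g ω)) ^ 2 / (4 * A))) ≤ ENNReal.ofReal (Real.exp 2) +
      ∫⁻ x, ENNReal.ofReal (Real.exp (‖radialSum s (gaussianCoeff g ω) x‖ ^ 2 /
        (4 * blockVariance s x))) ∂ν := by
    intro ω
    have hcr := (continuous_radialSum s (gaussianCoeff g ω)).measurable
    refine exp_norm_le_lintegral_exp ν hν1 (a := q / 2) (by linarith) (by linarith)
      (by fun_prop) (fun x => ?_) ?_
    · have := blockVariance_nonneg s x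
      positivity
    · rw [hν, lintegral_withDensity_eq_lintegral_mul _ hWm (by fun_prop)]
      have e : ∀ x, (W * fun x => ENNReal.ofReal ((‖radialSum s (gaussianCoeff g ω) x‖ ^ 2 /
          (4 * blockVariance s x)) ^ (q / 2))) x = ENNReal.ofReal (((4 * A) ^ (q / 2))⁻¹) *
          ‖radialSum s (gaussianCoeff g ω) x‖ₑ ^ q := by
        intro x
        have e1 : ‖radialSum s (gaussianCoeff g ω) x‖ₑ ^ q =
            ENNReal.ofReal ((‖radialSum s (gaussianCoeff g ω) x‖ ^ 2) ^ (q / 2)) := by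
          rw [← ofReal_norm, ENNReal.ofReal_rpow_of_nonneg (norm_nonneg _) hq0.le,
            ← Real.rpow_natCast, ← Real.rpow_mul (norm_nonneg _)]
          congr 2
          push_cast
          ring
        have hb := blockVariance_nonneg s x
        rw [Pi.mul_apply, hW, e1, ← ENNReal.ofReal_mul (by positivity),
          ← ENNReal.ofReal_mul (by positivity)]
        congr 1
        rcases hb.eq_or_lt with h0 | h0
        · rw [radialSum_eq_zero_of_blockVariance_eq_zero h0.symm, ← h0]
          have : q / 2 ≠ 0 := by positivity
          simp [Real.zero_rpow this]
        · rw [← Real.mul_rpow (by positivity) (by positivity), ← Real.inv_rpow (by positivity),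
            ← Real.mul_rpow (by positivity) (by positivity)]
          congr 1
          field_simp
      simp_rw [e]
      rw [lintegral_const_mul _ (by fun_prop), ← ofReal_lqNorm_rpow hq0 (memLp_radialSum _ _ _),
        ← ENNReal.ofReal_mul (by positivity)]
      apply ENNReal.ofReal_le_ofReal
      rw [Real.div_rpow (by positivity) (by positivity), ← Real.rpow_natCast,
        ← Real.rpow_mul (lqNorm_nonneg _ _), inv_mul_eq_div]
      apply le_of_eq
      congr 2
      push_cast
      ring
  refine (lintegral_mono hpt).trans ?_
  have hjm := hg.measurable_radialSum s
  have hjm2 : Measurable fun z : Ω × Plane => blockVariance s z.2 := hcont.comp measurable_snd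
  rw [lintegral_add_left measurable_const, lintegral_const, measure_univ, mul_one,
    lintegral_lintegral_swap (by
      apply Measurable.aemeasurable
      simp only [Function.uncurry_def]
      fun_prop), ENNReal.ofReal_add (Real.exp_pos _).le (by norm_num)]
  gcongr
  calc _ ≤ ∫⁻ _, ENNReal.ofReal (4 / 3) ∂ν :=
        lintegral_mono fun x => hg.lintegral_exp_radialSum_le s x
    _ ≤ _ := by
        rw [lintegral_const]
        exact mul_le_of_le_one_right' hν1

end

/-! ### Uniform exponential integrability at bounded renormalized mass -/

theorem massMean_mono {m n : ℕ} (h : m ≤ n) : massMean m ≤ massMean n :=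
  Finset.sum_le_sum_of_subset_of_nonneg
    (Finset.range_mono (by omega)) fun i _ _ => by positivity

/-- The renormalized mass `∑_{j ≤ n} (|g_j|² - 1) / (4j+2) = ‖u_n‖² - α_n`. -/
def renormMass {Ω : Type*} (g : ℕ → Ω → ℂ) (n : ℕ) (ω : Ω) : ℝ :=
  ∑ j ∈ Finset.range (n + 1), (‖g j ω‖ ^ 2 - 1) / (4 * (j : ℝ) + 2)

/-- The truncated Gaussian series `∑_{j ≤ n} g_j / √(4j+2) e_j`. -/
def gaussianSeries {Ω : Type*} (g : ℕ → Ω → ℂ) (n : ℕ) (ω : Ω) : Plane → ℂ :=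
  radialSum (Finset.range (n + 1)) (gaussianCoeff g ω)

theorem sum_gaussianCoeff_sq {Ω : Type*} (g : ℕ → Ω → ℂ) (n : ℕ) (ω : Ω) :
    ∑ j ∈ Finset.range (n + 1), ‖gaussianCoeff g ω j‖ ^ 2 = renormMass g n ω + massMean n := by
  rw [renormMass, massMean, ← Finset.sum_add_distrib]
  refine Finset.sum_congr rfl fun j _ => ?_
  rw [norm_gaussianCoeff_sq]
  ring

theorem lqNorm_add_le {q : ℝ} (hq : 1 ≤ q) {v w : Plane → ℂ}
    (hv : MemLp v (ENNReal.ofReal q) volume) (hw : MemLp w (ENNReal.ofReal q) volume) :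
    lqNorm q (v + w) ≤ lqNorm q v + lqNorm q w := by
  rw [lqNorm, lqNorm, lqNorm, ← ENNReal.toReal_add hv.2.ne hw.2.ne]
  exact ENNReal.toReal_mono (ENNReal.add_ne_top.2 ⟨hv.2.ne, hw.2.ne⟩)
    (eLpNorm_add_le hv.1 hw.1 (by simpa using hq))

theorem sum_range_eq_low_add_high {M : Type*} [AddCommMonoid M] (f : ℕ → M) (N n : ℕ) :
    ∑ j ∈ Finset.range (n + 1), f j = ∑ j ∈ Finset.range (min N n + 1), f j +
      ∑ j ∈ Finset.Ico (N + 1) (n + 1), f j := by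
  rcases le_total n N with h | h
  · rw [min_eq_right h, Finset.Ico_eq_empty_of_le (by omega), Finset.sum_empty, add_zero]
  · rw [min_eq_left h, Finset.sum_range_add_sum_Ico _ (by omega)]

theorem lqNorm_radialSum_rpow_le {q : ℝ} (hq2 : 2 ≤ q) (hq4 : q ≤ 4) (N : ℕ) (c : ℕ → ℂ) :
    lqNorm q (radialSum (Finset.range (N + 1)) c) ^ q ≤
      (∑ j ∈ Finset.range (N + 1), ‖c j‖ ^ 2) ^ (q / 2) *
        (2 * ((N : ℝ) + 1) * massMean N ^ 2) ^ ((q - 2) / 2) := by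
  have hE : 0 ≤ ∑ j ∈ Finset.range (N + 1), ∫ x : Plane, eigenfun j x ^ 4 :=
    Finset.sum_nonneg fun j _ => integral_eigenfun_pow_four_nonneg j
  have h1 := lintegral_enorm_radialSum_rpow_le hq2 hq4 (Finset.range (N + 1)) c
  rw [← ofReal_lqNorm_rpow (by linarith) (memLp_radialSum _ _ _),
    ENNReal.ofReal_le_ofReal_iff (by positivity)] at h1
  refine h1.trans ?_
  have h2 : ((Finset.range (N + 1)).card : ℝ) *
      ∑ j ∈ Finset.range (N + 1), ∫ x : Plane, eigenfun j x ^ 4 ≤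
      2 * ((N : ℝ) + 1) * massMean N ^ 2 := by
    rw [Finset.card_range]
    have := sum_integral_eigenfun_pow_four_le N
    push_cast
    calc _ ≤ ((N : ℝ) + 1) * (2 * massMean N ^ 2) := by gcongr
      _ = _ := by ring
  have h3 := Real.rpow_le_rpow (by positivity) h2 (show 0 ≤ (q - 2) / 2 by linarith)
  gcongr

section

variable {Ω : Type*} [MeasurableSpace Ω] {P : Measure Ω} {g : ℕ → Ω → ℂ}

theorem IsGaussianSequence.measurable_renormMass (hg : IsGaussianSequence P g) (n : ℕ) :
    Measurable (renormMass g n) :=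
  Finset.measurable_sum _ fun j _ => by have := hg.measurable j; fun_prop

theorem IsGaussianSequence.measurable_lqNorm (hg : IsGaussianSequence P g) {q : ℝ} (hq : 0 < q)
    (s : Finset ℕ) : Measurable fun ω => lqNorm q (radialSum s (gaussianCoeff g ω)) := by
  have h0 : ENNReal.ofReal q ≠ 0 := by simpa using hq
  have h1 : Measurable fun z : Ω × Plane => ‖radialSum s (gaussianCoeff g z.1) z.2‖ₑ ^ q :=
    (hg.measurable_radialSum s).enorm.pow_const q
  simp only [lqNorm, eLpNorm_eq_lintegral_rpow_enorm_toReal h0 ENNReal.ofReal_ne_top,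
    ENNReal.toReal_ofReal hq.le]
  exact (h1.lintegral_prod_right'.pow_const _).ennreal_toReal

/-- Splitting of the tail of `‖u_n‖_q` at a frequency `N`: either the mass of the high frequencies
deviates, or the high frequencies are large in `L^q`; the low frequencies are controlled by the
mass through the Bernstein inequality. -/
theorem IsGaussianSequence.measure_tail_le (hg : IsGaussianSequence P g) [IsProbabilityMeasure P]
    {q C A L : ℝ} (hq2 : 2 ≤ q) (hq4 : q ≤ 4) (hA : 0 < A) (hL : 0 ≤ L) (N n : ℕ)
    (hlow : (C + 1 + massMean N) ^ (q / 2) *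
      (2 * ((N : ℝ) + 1) * massMean N ^ 2) ^ ((q - 2) / 2) < (L / 2) ^ q)
    (hS : ∀ s : Finset ℕ, (∀ j ∈ s, N ≤ j) →
      ∫⁻ x, ENNReal.ofReal (blockVariance s x ^ (q / 2)) ≤ ENNReal.ofReal (A ^ (q / 2))) :
    P {ω | |renormMass g n ω| ≤ C ∧ L ≤ lqNorm q (gaussianSeries g n ω)} ≤
      ENNReal.ofReal (Real.exp (-(((N : ℝ) + 1) / 2))) +
        ENNReal.ofReal ((Real.exp 2 + 4 / 3) * Real.exp (-(L ^ 2 / (16 * A)))) := by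
  have hq0 : 0 < q := by linarith
  set k := min N n with hk
  set H := Finset.Ico (N + 1) (n + 1) with hH
  set B1 := {ω | ∑ j ∈ H, (‖g j ω‖ ^ 2 - 1) / (4 * (j : ℝ) + 2) ≤ -1} with hB1
  set B2 := {ω | L / 2 ≤ lqNorm q (radialSum H (gaussianCoeff g ω))} with hB2
  have hsub : {ω | |renormMass g n ω| ≤ C ∧ L ≤ lqNorm q (gaussianSeries g n ω)} ⊆ B1 ∪ B2 := by
    intro ω hω
    obtain ⟨h1, h2⟩ := hω
    by_contra hcon
    rw [Set.mem_union, not_or] at hcon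
    obtain ⟨h3, h4⟩ := hcon
    simp only [hB1, hB2, Set.mem_ofPred_eq, not_le] at h3 h4
    have h5 : renormMass g n ω = renormMass g k ω +
        ∑ j ∈ H, (‖g j ω‖ ^ 2 - 1) / (4 * (j : ℝ) + 2) := by
      rw [renormMass, renormMass, sum_range_eq_low_add_high _ N n]
    have h6 : gaussianSeries g n ω = radialSum (Finset.range (k + 1)) (gaussianCoeff g ω) +
        radialSum H (gaussianCoeff g ω) := by
      funext x
      rw [gaussianSeries, Pi.add_apply, radialSum, radialSum, radialSum,
        sum_range_eq_low_add_high _ N n]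
    have h7 := lqNorm_radialSum_rpow_le hq2 hq4 k (gaussianCoeff g ω)
    rw [sum_gaussianCoeff_sq] at h7
    have h8 : massMean k ≤ massMean N := massMean_mono (min_le_left _ _)
    have h9 : (k : ℝ) ≤ N := by exact_mod_cast min_le_left N n
    have h10 : renormMass g k ω + massMean k ≤ C + 1 + massMean N := by
      have := (abs_le.1 h1).2
      linarith
    have h11 : 0 ≤ renormMass g k ω + massMean k := by
      rw [← sum_gaussianCoeff_sq]; positivity
    have h12 := massMean_nonneg k
    have h13 : lqNorm q (radialSum (Finset.range (k + 1)) (gaussianCoeff g ω)) ^ q <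
        (L / 2) ^ q := by
      refine h7.trans_lt (lt_of_le_of_lt ?_ hlow)
      have h14 : 2 * ((k : ℝ) + 1) * massMean k ^ 2 ≤ 2 * ((N : ℝ) + 1) * massMean N ^ 2 := by
        gcongr
      apply mul_le_mul (Real.rpow_le_rpow h11 h10 (by linarith))
        (Real.rpow_le_rpow (by positivity) h14 (by linarith)) (by positivity)
        (Real.rpow_nonneg (h11.trans h10) _)
    have h15 := (Real.rpow_lt_rpow_iff (lqNorm_nonneg _ _) (by positivity) hq0).1 h13
    have h16 := lqNorm_add_le (q := q) (by linarith)
      (memLp_radialSum (Finset.range (k + 1)) (gaussianCoeff g ω) (ENNReal.ofReal q))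
      (memLp_radialSum H (gaussianCoeff g ω) (ENNReal.ofReal q))
    rw [← h6] at h16
    linarith
  refine (measure_mono hsub).trans ((measure_union_le _ _).trans (add_le_add ?_ ?_))
  · refine (hg.measure_mass_block_le (N + 1) (n + 1)).trans ?_
    apply ENNReal.ofReal_le_ofReal
    apply Real.exp_le_exp.2
    push_cast
    linarith
  · have h1 := hg.lintegral_exp_lqNorm_sq_le hq0 hq4 hA H
      (hS H fun j hj => by have := (Finset.mem_Ico.1 hj).1; omega)
    have h2 : B2 ⊆ {ω | ENNReal.ofReal (Real.exp (L ^ 2 / (16 * A))) ≤ ENNReal.ofReal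
        (Real.exp (lqNorm q (radialSum H (gaussianCoeff g ω)) ^ 2 / (4 * A)))} := by
      intro ω hω
      simp only [hB2, Set.mem_ofPred_eq] at hω ⊢
      apply ENNReal.ofReal_le_ofReal
      apply Real.exp_le_exp.2
      rw [div_le_div_iff₀ (by positivity) (by positivity)]
      have : (L / 2) ^ 2 ≤ lqNorm q (radialSum H (gaussianCoeff g ω)) ^ 2 := by gcongr
      nlinarith
    refine (measure_mono h2).trans ?_
    have hm := hg.measurable_lqNorm hq0 H
    refine (meas_ge_le_lintegral_div
      ((hm.pow_const 2).div_const _).exp.ennreal_ofReal.aemeasurable (by simpa using Real.exp_pos _)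
      ENNReal.ofReal_ne_top).trans ?_
    rw [ENNReal.div_le_iff (by simpa using Real.exp_pos _) ENNReal.ofReal_ne_top,
      ← ENNReal.ofReal_mul (by positivity), mul_assoc, ← Real.exp_add, neg_add_cancel,
      Real.exp_zero, mul_one]
    exact h1

/-- At bounded renormalized mass, `‖u_n‖_q` has tails `exp(-c L^γ)` with `γ > q`, uniformly in `n`.
This is where `q < 4` enters: the frequency cut `N = L^β` may be taken with `β > q` while
`β (q-2)/2 < q`. -/
theorem IsGaussianSequence.exists_measure_tail_le (hg : IsGaussianSequence P g)
    [IsProbabilityMeasure P] {q C : ℝ} (hq2 : 2 < q) (hq4 : q < 4) (hC : 0 ≤ C) :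
    ∃ γ c K : ℝ, q < γ ∧ 0 < c ∧ 0 ≤ K ∧ ∀ᶠ l : ℕ in atTop, ∀ n : ℕ,
      P {ω | |renormMass g n ω| ≤ C ∧ (l : ℝ) ≤ lqNorm q (gaussianSeries g n ω)} ≤
        ENNReal.ofReal (K * Real.exp (-(c * (l : ℝ) ^ γ))) := by
  have hq0 : 0 < q := by linarith
  set r := (q - 2) / 2 with hr
  have hr0 : 0 < r := by rw [hr]; linarith
  have hr1 : r < 1 := by rw [hr]; linarith
  set β := (q + q / r) / 2 with hβ
  have hβq : q < β := by
    have : q < q / r := by rw [lt_div_iff₀ hr0]; nlinarith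
    rw [hβ]; linarith
  have hβ0 : 0 < β := by linarith
  have hβr : β * r < q := by
    have : β * r = (q * r + q) / 2 := by rw [hβ]; field_simp
    rw [this]; nlinarith
  have hκ1 : (q - 2) / β < 1 - 2 / q := by
    have : (q - 2) / β < (q - 2) / q := div_lt_div_of_pos_left (by linarith) hq0 hβq
    have e : (q - 2) / q = 1 - 2 / q := by field_simp
    linarith
  obtain ⟨κ, hκl, hκu⟩ := exists_between hκ1
  have hκ0 : 0 < κ := lt_trans (div_pos (by linarith) hβ0) hκl
  have hβκ : q < 2 + β * κ := by
    rw [div_lt_iff₀ hβ0] at hκl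
    linarith
  obtain ⟨C1, hC1, hvar⟩ := exists_lintegral_blockVariance_rpow_le hq2 hq4.le hκ0.le hκu
  set ε := (q - β * r) / (2 * β * (q / 2 + 2 * r)) with hε
  have hε0 : 0 < ε := div_pos (by linarith) (by positivity)
  set e := ε * (q / 2) + (1 + 2 * ε) * r with he
  have he0 : 0 ≤ e := by positivity
  have hβe : β * e < q := by
    have h1 : β * e = β * r + (q - β * r) / 2 := by
      have : ε * (2 * β * (q / 2 + 2 * r)) = q - β * r := div_mul_cancel₀ _ (by positivity)
      rw [he]
      linear_combination (1 / 2) * this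
    rw [h1]; linarith
  set K := 1 + 1 / ε with hK
  have hK0 : 0 < K := by positivity
  set D := (C + 1 + K) ^ (q / 2) * (2 * K ^ 2) ^ r with hD
  have hD0 : 0 < D := by positivity
  have hev : ∀ᶠ l : ℕ in atTop, D * 2 ^ e * 2 ^ q < (l : ℝ) ^ (q - β * e) :=
    ((tendsto_rpow_atTop (by linarith)).comp tendsto_natCast_atTop_atTop).eventually_gt_atTop _
  refine ⟨min β (2 + β * κ), min (1 / 2) (1 / (16 * C1)), 1 + (Real.exp 2 + 4 / 3),
    lt_min hβq hβκ, by positivity, by positivity, ?_⟩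
  filter_upwards [hev, eventually_ge_atTop 1] with l hl hl1 n
  have hl1' : (1 : ℝ) ≤ l := by exact_mod_cast hl1
  have hl0 : (0 : ℝ) < l := by linarith
  set N := ⌊(l : ℝ) ^ β⌋₊ with hN
  have hNge : (l : ℝ) ^ β ≤ (N : ℝ) + 1 := (Nat.lt_floor_add_one _).le
  have hNle : (N : ℝ) + 1 ≤ 2 * (l : ℝ) ^ β := by
    have h1 : (N : ℝ) ≤ (l : ℝ) ^ β := Nat.floor_le (by positivity)
    have h2 : (1 : ℝ) ≤ (l : ℝ) ^ β := Real.one_le_rpow hl1' hβ0.le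
    linarith
  have hN1 : (1 : ℝ) ≤ (N : ℝ) + 1 := by simp
  have hN0 : (0 : ℝ) < (N : ℝ) + 1 := by positivity
  have hmm := massMean_le_rpow hε0 N
  have hm0 := massMean_nonneg N
  have hlow : (C + 1 + massMean N) ^ (q / 2) *
      (2 * ((N : ℝ) + 1) * massMean N ^ 2) ^ ((q - 2) / 2) < ((l : ℝ) / 2) ^ q := by
    have hNε : (1 : ℝ) ≤ ((N : ℝ) + 1) ^ ε := Real.one_le_rpow hN1 hε0.le
    have h1 : C + 1 + massMean N ≤ (C + 1 + K) * ((N : ℝ) + 1) ^ ε := by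
      have : C + 1 ≤ (C + 1) * ((N : ℝ) + 1) ^ ε := le_mul_of_one_le_right (by linarith) hNε
      linarith
    have h2 : 2 * ((N : ℝ) + 1) * massMean N ^ 2 ≤ (2 * K ^ 2) * ((N : ℝ) + 1) ^ (1 + 2 * ε) := by
      calc _ ≤ 2 * ((N : ℝ) + 1) * (K * ((N : ℝ) + 1) ^ ε) ^ 2 := by gcongr
        _ = _ := by
          rw [mul_pow, ← Real.rpow_natCast (((N : ℝ) + 1) ^ ε), ← Real.rpow_mul hN0.le,
            Real.rpow_add hN0, Real.rpow_one]
          push_cast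
          ring_nf
    calc _ ≤ ((C + 1 + K) * ((N : ℝ) + 1) ^ ε) ^ (q / 2) *
          ((2 * K ^ 2) * ((N : ℝ) + 1) ^ (1 + 2 * ε)) ^ r := by
          apply mul_le_mul (Real.rpow_le_rpow (by linarith) h1 (by linarith))
            (Real.rpow_le_rpow (by positivity) h2 hr0.le) (by positivity) (by positivity)
      _ = D * ((N : ℝ) + 1) ^ e := by
          rw [Real.mul_rpow (by positivity) (by positivity),
            Real.mul_rpow (by positivity) (by positivity), ← Real.rpow_mul hN0.le,
            ← Real.rpow_mul hN0.le, he, Real.rpow_add hN0, hD]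
          ring
      _ ≤ D * (2 * (l : ℝ) ^ β) ^ e := by gcongr
      _ = D * 2 ^ e * (l : ℝ) ^ (β * e) := by
          rw [Real.mul_rpow (by positivity) (by positivity), ← Real.rpow_mul hl0.le]
          ring
      _ < ((l : ℝ) / 2) ^ q := by
          rw [Real.div_rpow hl0.le (by norm_num), lt_div_iff₀ (by positivity)]
          calc _ = (D * 2 ^ e * 2 ^ q) * (l : ℝ) ^ (β * e) := by ring
            _ < (l : ℝ) ^ (q - β * e) * (l : ℝ) ^ (β * e) := by gcongr
            _ = _ := by rw [← Real.rpow_add hl0]; ring_nf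
  have hA0 : 0 < C1 * ((N : ℝ) + 1) ^ (-κ) := by positivity
  refine (hg.measure_tail_le hq2.le hq4.le hA0 hl0.le N n hlow (hvar N)).trans ?_
  rw [← ENNReal.ofReal_add (by positivity) (by positivity)]
  have hexp1 : Real.exp (-(((N : ℝ) + 1) / 2)) ≤
      Real.exp (-(min (1 / 2) (1 / (16 * C1)) * (l : ℝ) ^ min β (2 + β * κ))) := by
    apply Real.exp_le_exp.2
    apply neg_le_neg
    calc _ ≤ 1 / 2 * (l : ℝ) ^ β := by
          gcongr
          · exact min_le_left _ _
          · exact min_le_left _ _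
      _ ≤ _ := by linarith
  have hexp2 : Real.exp (-((l : ℝ) ^ 2 / (16 * (C1 * ((N : ℝ) + 1) ^ (-κ))))) ≤
      Real.exp (-(min (1 / 2) (1 / (16 * C1)) * (l : ℝ) ^ min β (2 + β * κ))) := by
    apply Real.exp_le_exp.2
    apply neg_le_neg
    calc _ ≤ 1 / (16 * C1) * (l : ℝ) ^ (2 + β * κ) := by
          gcongr
          · exact min_le_right _ _
          · exact min_le_right _ _
      _ = 1 / (16 * C1) * ((l : ℝ) ^ 2 * ((l : ℝ) ^ β) ^ κ) := by
          rw [Real.rpow_add hl0, Real.rpow_mul hl0.le, Real.rpow_two]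
      _ ≤ 1 / (16 * C1) * ((l : ℝ) ^ 2 * ((N : ℝ) + 1) ^ κ) := by gcongr
      _ = _ := by
          rw [Real.rpow_neg hN0.le]
          field_simp
  apply ENNReal.ofReal_le_ofReal
  rw [add_mul 1, one_mul]
  gcongr

/-- Uniform exponential integrability: `E[1_{|M_n| ≤ C} exp(R ‖u_n‖_q^q)]` is bounded in `n`. -/
theorem IsGaussianSequence.exists_lintegral_exp_le (hg : IsGaussianSequence P g)
    [IsProbabilityMeasure P] {q C R : ℝ} (hq2 : 2 < q) (hq4 : q < 4) (hC : 0 ≤ C) (hR : 0 ≤ R) :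
    ∃ B : ℝ≥0∞, B ≠ ⊤ ∧ ∀ n : ℕ,
      ∫⁻ ω, {ω | |renormMass g n ω| ≤ C}.indicator
        (fun ω => ENNReal.ofReal (Real.exp (R * lqNorm q (gaussianSeries g n ω) ^ q))) ω ∂P ≤ B := by
  have hq0 : 0 < q := by linarith
  obtain ⟨γ, c, K, hγ, hc, hK, htail⟩ := hg.exists_measure_tail_le hq2 hq4 hC
  have hev : ∀ᶠ l : ℕ in atTop, (R * 2 ^ q + 1) / c < (l : ℝ) ^ (γ - q) :=
    ((tendsto_rpow_atTop (by linarith)).comp tendsto_natCast_atTop_atTop).eventually_gt_atTop _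
  obtain ⟨l0, hl0⟩ := eventually_atTop.1 ((htail.and hev).and (eventually_ge_atTop 1))
  have hsum : Summable fun l : ℕ => K * Real.exp (-(l : ℝ)) := by
    refine Summable.mul_left K ?_
    simpa using Real.summable_exp_neg_nat
  refine ⟨ENNReal.ofReal (Real.exp (R * (l0 : ℝ) ^ q)) +
    ∑' l : ℕ, ENNReal.ofReal (K * Real.exp (-(l : ℝ))), ?_, fun n => ?_⟩
  · rw [← ENNReal.ofReal_tsum_of_nonneg (fun l => by positivity) hsum]
    exact ENNReal.add_ne_top.2 ⟨ENNReal.ofReal_ne_top, ENNReal.ofReal_ne_top⟩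
  · set E : ℕ → Set Ω := fun l =>
      {ω | |renormMass g n ω| ≤ C ∧ (l : ℝ) ≤ lqNorm q (gaussianSeries g n ω)} with hE
    have hM := hg.measurable_renormMass n
    have hX : Measurable fun ω => lqNorm q (gaussianSeries g n ω) := hg.measurable_lqNorm hq0 _
    have hEm : ∀ l, MeasurableSet (E l) := fun l =>
      (measurableSet_le hM.abs measurable_const).inter (measurableSet_le measurable_const hX)
    set T : ℕ → Ω → ℝ≥0∞ := fun l => if l0 ≤ l then (E l).indicator
      (fun _ => ENNReal.ofReal (Real.exp (R * ((l : ℝ) + 1) ^ q))) else 0 with hT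
    have hTm : ∀ l, Measurable (T l) := by
      intro l
      simp only [hT]
      split_ifs
      · exact measurable_const.indicator (hEm l)
      · exact measurable_zero
    have hpt : ∀ ω, {ω | |renormMass g n ω| ≤ C}.indicator
        (fun ω => ENNReal.ofReal (Real.exp (R * lqNorm q (gaussianSeries g n ω) ^ q))) ω ≤
        ENNReal.ofReal (Real.exp (R * (l0 : ℝ) ^ q)) + ∑' l, T l ω := by
      intro ω
      by_cases hω : |renormMass g n ω| ≤ C
      · rw [Set.indicator_of_mem (show ω ∈ {ω | |renormMass g n ω| ≤ C} from hω)]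
        have hX0 : 0 ≤ lqNorm q (gaussianSeries g n ω) := lqNorm_nonneg _ _
        set l := ⌊lqNorm q (gaussianSeries g n ω)⌋₊ with hl
        have h1 : (l : ℝ) ≤ lqNorm q (gaussianSeries g n ω) := Nat.floor_le hX0
        have h2 : lqNorm q (gaussianSeries g n ω) ≤ (l : ℝ) + 1 := (Nat.lt_floor_add_one _).le
        by_cases hll : l0 ≤ l
        · refine le_trans ?_ le_add_self
          refine le_trans ?_ (ENNReal.le_tsum l)
          simp only [hT, if_pos hll]
          rw [Set.indicator_of_mem (show ω ∈ E l from ⟨hω, h1⟩)]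
          apply ENNReal.ofReal_le_ofReal
          gcongr
        · refine le_trans ?_ le_self_add
          have h3 : (l : ℝ) + 1 ≤ l0 := by exact_mod_cast not_le.1 hll
          apply ENNReal.ofReal_le_ofReal
          have := h2.trans h3
          gcongr
      · rw [Set.indicator_of_notMem (show ω ∉ {ω | |renormMass g n ω| ≤ C} from hω)]
        exact zero_le
    refine (lintegral_mono hpt).trans ?_
    rw [lintegral_add_left measurable_const, lintegral_const, measure_univ, mul_one,
      lintegral_tsum fun l => (hTm l).aemeasurable]
    gcongr with l
    by_cases hll : l0 ≤ l
    · simp only [hT, if_pos hll]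
      rw [lintegral_indicator_const (hEm l)]
      obtain ⟨⟨h1, h2⟩, h3⟩ := hl0 l hll
      have h3' : (1 : ℝ) ≤ l := by exact_mod_cast h3
      have hlpos : (0 : ℝ) < l := by linarith
      calc _ ≤ ENNReal.ofReal (Real.exp (R * ((l : ℝ) + 1) ^ q)) *
            ENNReal.ofReal (K * Real.exp (-(c * (l : ℝ) ^ γ))) := by gcongr; exact h1 n
        _ ≤ _ := by
            rw [← ENNReal.ofReal_mul (Real.exp_pos _).le]
            apply ENNReal.ofReal_le_ofReal
            rw [mul_left_comm, ← Real.exp_add]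
            gcongr
            have h4 : ((l : ℝ) + 1) ^ q ≤ 2 ^ q * (l : ℝ) ^ q := by
              rw [← Real.mul_rpow (by norm_num) hlpos.le]
              apply Real.rpow_le_rpow (by positivity) (by linarith) hq0.le
            have h5 : (l : ℝ) ≤ (l : ℝ) ^ q := by
              simpa using Real.rpow_le_rpow_of_exponent_le h3' (show (1 : ℝ) ≤ q by linarith)
            rw [div_lt_iff₀ hc] at h2
            have h6 : (R * 2 ^ q + 1) * (l : ℝ) ^ q ≤ c * (l : ℝ) ^ γ := by
              have e : (l : ℝ) ^ γ = (l : ℝ) ^ (γ - q) * (l : ℝ) ^ q := by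
                rw [← Real.rpow_add hlpos]; ring_nf
              rw [e]
              have : 0 ≤ (l : ℝ) ^ q := by positivity
              nlinarith
            nlinarith
    · simp [hT, hll]

end

/-! ### Convergence criteria -/

theorem eLpNorm_ofReal_eq {α : Type*} [MeasurableSpace α] (μ : Measure α) {r : ℝ} (hr : 0 < r)
    (f : α → ℝ) :
    eLpNorm f (ENNReal.ofReal r) μ = (∫⁻ x, ENNReal.ofReal (|f x| ^ r) ∂μ) ^ (1 / r) := by
  rw [eLpNorm_eq_lintegral_rpow_enorm_toReal (by simpa using hr) ENNReal.ofReal_ne_top,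
    ENNReal.toReal_ofReal hr.le]
  congr 1
  refine lintegral_congr fun x => ?_
  rw [← ofReal_norm, ENNReal.ofReal_rpow_of_nonneg (norm_nonneg _) hr.le, Real.norm_eq_abs]

/-- Almost everywhere convergence together with bounds on all moments gives convergence in every
`L^r`, `1 ≤ r < ∞`. -/
theorem memLp_and_tendsto_eLpNorm_of_moments {α : Type*} [MeasurableSpace α] {μ : Measure α}
    [IsFiniteMeasure μ] {f : ℕ → α → ℝ} {ρ : α → ℝ} (hf : ∀ k, Measurable (f k))
    (hlim : ∀ᵐ x ∂μ, Tendsto (fun k => f k x) atTop (𝓝 (ρ x)))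
    (hmom : ∀ r : ℝ, 1 ≤ r → ∃ B : ℝ≥0∞, B ≠ ⊤ ∧
      ∀ k, ∫⁻ x, ENNReal.ofReal (|f k x| ^ r) ∂μ ≤ B) {r : ℝ} (hr : 1 ≤ r) :
    (∀ k, MemLp (f k) (ENNReal.ofReal r) μ) ∧ MemLp ρ (ENNReal.ofReal r) μ ∧
      Tendsto (fun k => eLpNorm (fun x => f k x - ρ x) (ENNReal.ofReal r) μ) atTop (𝓝 0) := by
  have hr0 : 0 < r := by linarith
  have hr1 : 1 ≤ ENNReal.ofReal r := by simpa using hr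
  obtain ⟨B, hB, hfB⟩ := hmom r hr
  obtain ⟨B2, hB2, hfB2⟩ := hmom (2 * r) (by linarith)
  have hnorm : ∀ k, eLpNorm (f k) (ENNReal.ofReal r) μ ≤ B ^ (1 / r) := by
    intro k
    rw [eLpNorm_ofReal_eq μ hr0]
    gcongr
    exact hfB k
  have hBr : B ^ (1 / r) < ⊤ := ENNReal.rpow_lt_top_of_nonneg (by positivity) hB
  have hmem : ∀ k, MemLp (f k) (ENNReal.ofReal r) μ := fun k =>
    ⟨(hf k).aestronglyMeasurable, (hnorm k).trans_lt hBr⟩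
  have hρm : AEStronglyMeasurable ρ μ :=
    aestronglyMeasurable_of_tendsto_ae atTop (fun k => (hf k).aestronglyMeasurable) hlim
  have hρ : MemLp ρ (ENNReal.ofReal r) μ := by
    refine ⟨hρm, ((Lp.eLpNorm_lim_le_liminf_eLpNorm
      (fun k => (hf k).aestronglyMeasurable) ρ hlim).trans ?_).trans_lt hBr⟩
    exact liminf_le_of_frequently_le' (Frequently.of_forall hnorm)
  refine ⟨hmem, hρ, ?_⟩
  refine tendsto_Lp_finite_of_tendsto_ae hr1 ENNReal.ofReal_ne_top
    (fun k => (hf k).aestronglyMeasurable) hρ ?_ hlim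
  refine unifIntegrable_of hr1 ENNReal.ofReal_ne_top (fun k => (hf k).aestronglyMeasurable) ?_
  intro ε hε
  -- on `{C ≤ |f|}` one has `|f|^r ≤ C^{-r} |f|^{2r}`
  set b := (B2 ^ (1 / r)).toReal with hb
  have hb0 : 0 ≤ b := ENNReal.toReal_nonneg
  set C : ℝ := b / ε + 1 with hC
  have hC0 : 0 < C := by positivity
  refine ⟨⟨C, hC0.le⟩, fun k => ?_⟩
  rw [eLpNorm_ofReal_eq μ hr0]
  have hpt : ∀ x, ENNReal.ofReal
      (|Set.indicator {x | (⟨C, hC0.le⟩ : NNReal) ≤ ‖f k x‖₊} (f k) x| ^ r) ≤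
      ENNReal.ofReal ((C⁻¹) ^ r) * ENNReal.ofReal (|f k x| ^ (2 * r)) := by
    intro x
    rw [← ENNReal.ofReal_mul (by positivity)]
    apply ENNReal.ofReal_le_ofReal
    by_cases hx : x ∈ {x | (⟨C, hC0.le⟩ : NNReal) ≤ ‖f k x‖₊}
    · rw [Set.indicator_of_mem hx, Real.rpow_mul (abs_nonneg _),
        ← Real.mul_rpow (by positivity) (by positivity), Real.rpow_two]
      have hx' : C ≤ |f k x| := by
        have : (⟨C, hC0.le⟩ : NNReal) ≤ ‖f k x‖₊ := hx
        exact_mod_cast this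
      apply Real.rpow_le_rpow (abs_nonneg _) _ hr0.le
      rw [inv_mul_eq_div, le_div_iff₀ hC0, sq]
      gcongr
    · rw [Set.indicator_of_notMem hx, abs_zero, Real.zero_rpow hr0.ne']
      positivity
  have hmeas := (hf k)
  calc _ ≤ (ENNReal.ofReal ((C⁻¹) ^ r) * B2) ^ (1 / r) := by
        gcongr
        refine (lintegral_mono hpt).trans ?_
        rw [lintegral_const_mul _ (by fun_prop)]
        gcongr
        exact hfB2 k
    _ = ENNReal.ofReal (C⁻¹) * ENNReal.ofReal b := by
        rw [ENNReal.mul_rpow_of_nonneg _ _ (by positivity),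
          ENNReal.ofReal_rpow_of_nonneg (by positivity) (by positivity),
          ← Real.rpow_mul (by positivity), mul_one_div_cancel hr0.ne', Real.rpow_one, hb,
          ENNReal.ofReal_toReal (ENNReal.rpow_lt_top_of_nonneg (by positivity) hB2).ne]
    _ ≤ ENNReal.ofReal ε := by
        rw [← ENNReal.ofReal_mul (by positivity)]
        apply ENNReal.ofReal_le_ofReal
        rw [inv_mul_eq_div, div_le_iff₀ hC0, hC, mul_add, mul_div_cancel₀ _ hε.ne']
        linarith

/-- A sequence of random variables whose increments decay geometrically in `L¹` converges almost
surely. -/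
theorem ae_exists_tendsto_of_lintegral_abs_sub_le {α : Type*} [MeasurableSpace α] {μ : Measure α}
    {f : ℕ → α → ℝ} (hf : ∀ k, Measurable (f k)) {D θ : ℝ} (hD : 0 ≤ D) (hθ0 : 0 ≤ θ) (hθ1 : θ < 1)
    (h : ∀ k, ∫⁻ x, ENNReal.ofReal |f (k + 1) x - f k x| ∂μ ≤ ENNReal.ofReal (D * θ ^ k)) :
    ∀ᵐ x ∂μ, ∃ l, Tendsto (fun k => f k x) atTop (𝓝 l) := by
  have hm : ∀ k, Measurable fun x => ENNReal.ofReal |f (k + 1) x - f k x| := by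
    intro k
    have h1 := hf k
    have h2 := hf (k + 1)
    exact (h2.sub h1).abs.ennreal_ofReal
  have hfin : ∫⁻ x, ∑' k, ENNReal.ofReal |f (k + 1) x - f k x| ∂μ ≠ ⊤ := by
    rw [lintegral_tsum fun k => (hm k).aemeasurable]
    refine ne_top_of_le_ne_top ?_ (ENNReal.tsum_le_tsum h)
    rw [← ENNReal.ofReal_tsum_of_nonneg (fun k => by positivity)
      ((summable_geometric_of_lt_one hθ0 hθ1).mul_left D)]
    exact ENNReal.ofReal_ne_top
  filter_upwards [ae_lt_top (Measurable.tsum hm) hfin] with x hx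
  have hs := ENNReal.summable_toReal hx.ne
  refine cauchySeq_tendsto_of_complete (cauchySeq_of_summable_dist (hs.congr fun k => ?_))
  rw [ENNReal.toReal_ofReal (abs_nonneg _), dist_comm, Real.dist_eq]

theorem abs_lqNorm_add_sub_le {q : ℝ} (hq : 1 ≤ q) {v w : Plane → ℂ}
    (hv : MemLp v (ENNReal.ofReal q) volume) (hw : MemLp w (ENNReal.ofReal q) volume) :
    |lqNorm q (v + w) - lqNorm q v| ≤ lqNorm q w := by
  have h1 := lqNorm_add_le hq hv hw
  have h2 := lqNorm_add_le hq (hv.add hw) hw.neg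
  have h3 : lqNorm q (-w) = lqNorm q w := by rw [lqNorm, lqNorm, eLpNorm_neg]
  rw [add_neg_cancel_right, h3] at h2
  rw [abs_le]
  constructor <;> linarith

/-! ### Almost sure convergence and moments of the truncated densities -/

section

variable {Ω : Type*} [MeasurableSpace Ω] {P : Measure Ω} {g : ℕ → Ω → ℂ}

theorem IsGaussianSequence.ae_tendsto_renormMass (hg : IsGaussianSequence P g) :
    ∀ᵐ ω ∂P, ∃ l, Tendsto (fun k => renormMass g (2 ^ k) ω) atTop (𝓝 l) := by
  refine ae_exists_tendsto_of_lintegral_abs_sub_le (fun k => hg.measurable_renormMass _)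
    (D := 4) (θ := (2 : ℝ) ^ (-(1 / 2) : ℝ)) (by norm_num) (by positivity)
    (Real.rpow_lt_one_of_one_lt_of_neg (by norm_num) (by norm_num)) fun k => ?_
  have e : ∀ ω, renormMass g (2 ^ (k + 1)) ω - renormMass g (2 ^ k) ω =
      ∑ j ∈ Finset.Ico (2 ^ k + 1) (2 ^ (k + 1) + 1), (‖g j ω‖ ^ 2 - 1) / (4 * (j : ℝ) + 2) := by
    intro ω
    have h : 2 ^ k ≤ 2 ^ (k + 1) := Nat.pow_le_pow_right (by norm_num) (by omega)
    rw [renormMass, renormMass, sum_range_eq_low_add_high _ (2 ^ k) (2 ^ (k + 1)), min_eq_left h,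
      add_sub_cancel_left]
  simp_rw [e]
  refine (hg.lintegral_abs_mass_block_le _ _).trans ?_
  apply ENNReal.ofReal_le_ofReal
  gcongr
  rw [← Real.rpow_natCast, ← Real.rpow_mul (by norm_num), mul_comm, Real.rpow_mul (by norm_num),
    Real.rpow_natCast]
  apply Real.rpow_le_rpow_of_nonpos (by positivity) _ (by norm_num)
  push_cast
  linarith

/-- The increments are bounded by the `L^q` norms of dyadic blocks, which are geometrically small by
Gaussian concentration. -/
theorem IsGaussianSequence.ae_tendsto_lqNorm (hg : IsGaussianSequence P g)
    [IsProbabilityMeasure P] {q : ℝ} (hq2 : 2 < q) (hq4 : q ≤ 4) :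
    ∀ᵐ ω ∂P, ∃ l, Tendsto (fun k => lqNorm q (gaussianSeries g (2 ^ k) ω)) atTop (𝓝 l) := by
  have hq0 : 0 < q := by linarith
  have h2q : 2 / q < 1 := by rw [div_lt_one hq0]; exact hq2
  set κ := (1 - 2 / q) / 2 with hκ
  have hκ0 : 0 < κ := by rw [hκ]; linarith
  obtain ⟨C, hC, hvar⟩ := exists_lintegral_blockVariance_rpow_le hq2 hq4 hκ0.le
    (by rw [hκ]; linarith)
  set θ := (2 : ℝ) ^ (-(κ / 2)) with hθ
  have hθ0 : 0 < θ := by positivity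
  have hθ2 : θ ^ 2 = (2 : ℝ) ^ (-κ) := by
    rw [hθ, ← Real.rpow_natCast, ← Real.rpow_mul (by norm_num)]
    congr 1
    push_cast
    ring
  refine ae_exists_tendsto_of_lintegral_abs_sub_le (fun k => hg.measurable_lqNorm hq0 _)
    (D := 2 * Real.sqrt C * (Real.exp 2 + 4 / 3)) (θ := θ) (by positivity) hθ0.le
    (Real.rpow_lt_one_of_one_lt_of_neg (by norm_num) (by linarith)) fun k => ?_
  set H := Finset.Ico (2 ^ k + 1) (2 ^ (k + 1) + 1) with hH
  set A := C * (θ ^ k) ^ 2 with hA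
  have hA0 : 0 < A := by positivity
  have hAs : ∫⁻ x, ENNReal.ofReal (blockVariance H x ^ (q / 2)) ≤ ENNReal.ofReal (A ^ (q / 2)) := by
    refine (hvar (2 ^ k) H fun j hj => ?_).trans ?_
    · have := (Finset.mem_Ico.1 hj).1
      omega
    · apply ENNReal.ofReal_le_ofReal
      rw [hA]
      gcongr
      rw [← pow_mul, mul_comm k 2, pow_mul, hθ2, ← Real.rpow_natCast, ← Real.rpow_mul (by norm_num),
        mul_comm, Real.rpow_mul (by norm_num), Real.rpow_natCast]
      apply Real.rpow_le_rpow_of_nonpos (by positivity) _ (by linarith)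
      push_cast
      linarith
  have hpt : ∀ ω, ENNReal.ofReal |lqNorm q (gaussianSeries g (2 ^ (k + 1)) ω) -
      lqNorm q (gaussianSeries g (2 ^ k) ω)| ≤ ENNReal.ofReal (2 * Real.sqrt C * θ ^ k) *
      ENNReal.ofReal (Real.exp (lqNorm q (radialSum H (gaussianCoeff g ω)) ^ 2 / (4 * A))) := by
    intro ω
    rw [← ENNReal.ofReal_mul (by positivity)]
    apply ENNReal.ofReal_le_ofReal
    have h : 2 ^ k ≤ 2 ^ (k + 1) := Nat.pow_le_pow_right (by norm_num) (by omega)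
    have e : gaussianSeries g (2 ^ (k + 1)) ω = gaussianSeries g (2 ^ k) ω +
        radialSum H (gaussianCoeff g ω) := by
      funext x
      rw [Pi.add_apply, gaussianSeries, gaussianSeries, radialSum, radialSum, radialSum,
        sum_range_eq_low_add_high _ (2 ^ k) (2 ^ (k + 1)), min_eq_left h]
    rw [e]
    refine (abs_lqNorm_add_sub_le (by linarith) (memLp_radialSum _ _ _)
      (memLp_radialSum _ _ _)).trans ?_
    set X := lqNorm q (radialSum H (gaussianCoeff g ω)) with hX
    set t := 2 * Real.sqrt C * θ ^ k with ht
    have ht0 : 0 < t := by positivity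
    have ht2 : 4 * A = t ^ 2 := by
      rw [ht, hA, mul_pow, mul_pow, Real.sq_sqrt hC.le]; ring
    rw [ht2, ← div_pow]
    have h1 : X / t ≤ Real.exp ((X / t) ^ 2) := by
      have := Real.add_one_le_exp ((X / t) ^ 2)
      nlinarith [sq_nonneg (X / t - 1), sq_nonneg (X / t)]
    calc X = t * (X / t) := by field_simp
      _ ≤ _ := by gcongr
  refine (lintegral_mono hpt).trans ?_
  have hm := hg.measurable_lqNorm hq0 H
  rw [lintegral_const_mul _ ((hm.pow_const 2).div_const _).exp.ennreal_ofReal]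
  calc _ ≤ ENNReal.ofReal (2 * Real.sqrt C * θ ^ k) * ENNReal.ofReal (Real.exp 2 + 4 / 3) := by
        gcongr
        exact hg.lintegral_exp_lqNorm_sq_le hq0 hq4 hA0 H hAs
    _ = _ := by
        rw [← ENNReal.ofReal_mul (by positivity)]
        congr 1
        ring

/-- The truncated Gibbs density in terms of the Gaussian coordinates. -/
def gaussianDensity {Ω : Type*} (g : ℕ → Ω → ℂ) (q : ℝ) (χ : ℝ → ℝ) (n : ℕ) (ω : Ω) : ℝ :=
  χ (renormMass g n ω) * Real.exp (2 / q * lqNorm q (gaussianSeries g n ω) ^ q)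

theorem IsGaussianSequence.measurable_gaussianDensity (hg : IsGaussianSequence P g) {q : ℝ}
    (hq : 0 < q) {χ : ℝ → ℝ} (hχ : Continuous χ) (n : ℕ) :
    Measurable (gaussianDensity g q χ n) :=
  (hχ.measurable.comp (hg.measurable_renormMass n)).mul
    (((hg.measurable_lqNorm hq _).pow_const q).const_mul _).exp

theorem IsGaussianSequence.exists_moment_gaussianDensity_le (hg : IsGaussianSequence P g)
    [IsProbabilityMeasure P] {q : ℝ} (hq2 : 2 < q) (hq4 : q < 4) {χ : ℝ → ℝ} (hχ : Continuous χ)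
    (hχs : HasCompactSupport χ) {r : ℝ} (hr : 0 < r) :
    ∃ B : ℝ≥0∞, B ≠ ⊤ ∧ ∀ n, ∫⁻ ω, ENNReal.ofReal (|gaussianDensity g q χ n ω| ^ r) ∂P ≤ B := by
  have hq0 : 0 < q := by linarith
  obtain ⟨K, hK⟩ := hχs.exists_bound_of_continuous hχ
  have hK0 : 0 ≤ K := (norm_nonneg _).trans (hK 0)
  obtain ⟨C0, hC0⟩ := hχs.isCompact.isBounded.subset_closedBall (0 : ℝ)
  set C := max C0 0 with hC
  have hsupp : ∀ z, C < |z| → χ z = 0 := by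
    intro z hz
    by_contra h
    have h1 := hC0 (subset_tsupport χ h)
    rw [mem_closedBall_zero_iff, Real.norm_eq_abs] at h1
    have := le_max_left C0 0
    linarith
  obtain ⟨B, hB, hBn⟩ := hg.exists_lintegral_exp_le hq2 hq4 (C := C) (R := r * (2 / q))
    (le_max_right _ _) (by positivity)
  refine ⟨ENNReal.ofReal (K ^ r) * B, ENNReal.mul_ne_top ENNReal.ofReal_ne_top hB, fun n => ?_⟩
  have hpt : ∀ ω, ENNReal.ofReal (|gaussianDensity g q χ n ω| ^ r) ≤ ENNReal.ofReal (K ^ r) *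
      {ω | |renormMass g n ω| ≤ C}.indicator (fun ω => ENNReal.ofReal
        (Real.exp (r * (2 / q) * lqNorm q (gaussianSeries g n ω) ^ q))) ω := by
    intro ω
    by_cases hω : |renormMass g n ω| ≤ C
    · rw [Set.indicator_of_mem (show ω ∈ {ω | |renormMass g n ω| ≤ C} from hω),
        ← ENNReal.ofReal_mul (by positivity)]
      apply ENNReal.ofReal_le_ofReal
      rw [gaussianDensity, abs_mul, Real.abs_exp, Real.mul_rpow (abs_nonneg _) (Real.exp_pos _).le,
        ← Real.exp_mul]
      have h1 := hK (renormMass g n ω)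
      rw [Real.norm_eq_abs] at h1
      have h2 : 2 / q * lqNorm q (gaussianSeries g n ω) ^ q * r =
          r * (2 / q) * lqNorm q (gaussianSeries g n ω) ^ q := by ring
      rw [h2]
      gcongr
    · rw [gaussianDensity, hsupp _ (not_le.1 hω), zero_mul, abs_zero, Real.zero_rpow hr.ne',
        ENNReal.ofReal_zero]
      exact zero_le
  refine (lintegral_mono hpt).trans ?_
  have hm : Measurable ({ω | |renormMass g n ω| ≤ C}.indicator (fun ω => ENNReal.ofReal
      (Real.exp (r * (2 / q) * lqNorm q (gaussianSeries g n ω) ^ q)))) :=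
    (((hg.measurable_lqNorm hq0 _).pow_const q).const_mul _).exp.ennreal_ofReal.indicator
      (measurableSet_le (hg.measurable_renormMass n).abs measurable_const)
  rw [lintegral_const_mul _ hm]
  gcongr
  exact hBn n

/-- Along dyadic truncations, the renormalized mass and the `L^q` norm converge almost surely; the
limiting density is the corresponding function of the limits. -/
theorem IsGaussianSequence.exists_limits (hg : IsGaussianSequence P g)
    [IsProbabilityMeasure P] {q : ℝ} (hq2 : 2 < q) (hq4 : q ≤ 4) :
    ∃ M V : Ω → ℝ, ∀ᵐ ω ∂P, ∀ χ : ℝ → ℝ, Continuous χ →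
      Tendsto (fun k => gaussianDensity g q χ (2 ^ k) ω) atTop
        (𝓝 (χ (M ω) * Real.exp (2 / q * V ω ^ q))) := by
  have hq0 : 0 < q := by linarith
  refine ⟨fun ω => limUnder atTop fun k => renormMass g (2 ^ k) ω,
    fun ω => limUnder atTop fun k => lqNorm q (gaussianSeries g (2 ^ k) ω), ?_⟩
  filter_upwards [hg.ae_tendsto_renormMass, hg.ae_tendsto_lqNorm hq2 hq4] with ω h1 h2 χ hχ
  have h1' := tendsto_nhds_limUnder h1
  have h2' := tendsto_nhds_limUnder h2
  exact ((hχ.tendsto _).comp h1').mul ((Real.continuous_exp.tendsto _).comp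
    ((h2'.rpow_const (Or.inr hq0.le)).const_mul _))

end

/-! ### Gaussian coordinates on tempered distributions -/

theorem measurable_eval (φ : 𝓢(Plane, ℂ)) : Measurable fun u : 𝓢'(Plane, ℂ) => u φ := by
  intro s hs
  rw [BorelSpace.measurable_eq (α := ℂ)] at hs
  exact le_iSup (fun φ : 𝓢(Plane, ℂ) =>
    MeasurableSpace.comap (fun u : 𝓢'(Plane, ℂ) => u φ) (borel ℂ)) φ _ ⟨s, hs, rfl⟩

theorem measurable_of_eval {Ω : Type*} [MeasurableSpace Ω] {f : Ω → 𝓢'(Plane, ℂ)}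
    (h : ∀ φ : 𝓢(Plane, ℂ), Measurable fun ω => f ω φ) : Measurable f := by
  refine Measurable.of_le_map (iSup_le fun φ => ?_)
  rintro _ ⟨s, hs, rfl⟩
  rw [← BorelSpace.measurable_eq (α := ℂ)] at hs
  exact h φ hs

theorem gaussianPartialSum_apply {Ω : Type*} (g : ℕ → Ω → ℂ) (n : ℕ) (ω : Ω) (φ : 𝓢(Plane, ℂ)) :
    gaussianPartialSum g n ω φ =
      ∑ k ∈ Finset.range n, gaussianCoeff g ω k * eigenDistribution k φ := by
  have h := map_sum (PointwiseConvergenceCLM.evalCLM (RingHom.id ℂ) ℂ φ)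
    (fun k => gaussianCoeff g ω k • eigenDistribution k) (Finset.range n)
  exact h

theorem eigenDistribution_eigenSchwartz (k j : ℕ) :
    eigenDistribution k (eigenSchwartz j) = if j = k then 1 else 0 := by
  refine (SchwartzMap.toTemperedDistributionCLM_apply_apply volume (eigenSchwartz k)
    (eigenSchwartz j)).trans ?_
  simp only [eigenSchwartz_apply, smul_eq_mul]
  have h := integral_ofReal (𝕜 := ℂ) (f := fun x : Plane => eigenfun j x * eigenfun k x)
    (μ := volume)
  simp only [Complex.coe_algebraMap, RCLike.ofReal_mul] at h
  refine h.trans ?_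
  rw [integral_eigenfun_mul]
  split_ifs <;> simp

/-- The coordinate `√(4j+2) ⟨u, eⱼ⟩`, normalized so that it is a standard complex Gaussian under
the law of the random series. -/
def coordGaussian (j : ℕ) (u : 𝓢'(Plane, ℂ)) : ℂ :=
  u (eigenSchwartz j) * (Real.sqrt (4 * (j : ℝ) + 2) : ℂ)

theorem sqrt_weight_ne_zero (j : ℕ) : (Real.sqrt (4 * (j : ℝ) + 2) : ℂ) ≠ 0 := by
  rw [Ne, Complex.ofReal_eq_zero]
  positivity

theorem measurable_coordGaussian (j : ℕ) : Measurable (coordGaussian j) :=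
  (measurable_eval _).mul_const _

theorem gaussianCoeff_coordGaussian (u : 𝓢'(Plane, ℂ)) (j : ℕ) :
    gaussianCoeff coordGaussian u j = u (eigenSchwartz j) := by
  rw [gaussianCoeff, coordGaussian, mul_div_cancel_right₀ _ (sqrt_weight_ne_zero j)]

theorem proj_eq_gaussianSeries (n : ℕ) (u : 𝓢'(Plane, ℂ)) :
    proj n u = gaussianSeries coordGaussian n u := by
  funext x
  simp only [proj, gaussianSeries, radialSum, gaussianCoeff_coordGaussian]

theorem truncDensity_eq_gaussianDensity (p : ℝ) (χ : ℝ → ℝ) (n : ℕ) :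
    truncDensity p χ n = gaussianDensity coordGaussian (p + 1) χ n := by
  funext u
  rw [truncDensity, gaussianDensity, proj_eq_gaussianSeries]
  congr 2
  rw [gaussianSeries, lqNorm_two_radialSum_sq, sum_gaussianCoeff_sq, add_sub_cancel_right]

theorem coordGaussian_of_tendsto {Ω : Type*} {g : ℕ → Ω → ℂ} {f : Ω → 𝓢'(Plane, ℂ)}
    (hf : ∀ ω, Tendsto (fun n => gaussianPartialSum g n ω) atTop (𝓝 (f ω))) (j : ℕ) (ω : Ω) :
    coordGaussian j (f ω) = g j ω := by
  have h1 := PointwiseConvergenceCLM.tendsto_iff_forall_tendsto.1 (hf ω) (eigenSchwartz j)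
  have h2 : Tendsto (fun n => gaussianPartialSum g n ω (eigenSchwartz j)) atTop
      (𝓝 (gaussianCoeff g ω j)) := by
    refine tendsto_const_nhds.congr' ?_
    filter_upwards [eventually_gt_atTop j] with n hn
    simp [gaussianPartialSum_apply, eigenDistribution_eigenSchwartz, hn]
  rw [coordGaussian, tendsto_nhds_unique h1 h2, gaussianCoeff,
    div_mul_cancel₀ _ (sqrt_weight_ne_zero j)]

section

variable {Ω : Type*} [MeasurableSpace Ω] {P : Measure Ω} {g : ℕ → Ω → ℂ}
  {f : Ω → 𝓢'(Plane, ℂ)}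

theorem measurable_of_tendsto_gaussianPartialSum (hg : ∀ k, Measurable (g k))
    (hf : ∀ ω, Tendsto (fun n => gaussianPartialSum g n ω) atTop (𝓝 (f ω))) : Measurable f := by
  refine measurable_of_eval fun φ => ?_
  refine measurable_of_tendsto_metrizable (f := fun n ω => gaussianPartialSum g n ω φ)
    (fun n => ?_) (tendsto_pi_nhds.2 fun ω =>
      PointwiseConvergenceCLM.tendsto_iff_forall_tendsto.1 (hf ω) φ)
  simp only [gaussianPartialSum_apply, gaussianCoeff]
  exact Finset.measurable_fun_sum _ fun k _ => ((hg k).div_const _).mul_const _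

/-- Under the law of the random series, the coordinates are independent complex Gaussians. -/
theorem IsGaussianSequence.map_coordGaussian (hg : IsGaussianSequence P g)
    (hf : ∀ ω, Tendsto (fun n => gaussianPartialSum g n ω) atTop (𝓝 (f ω))) :
    IsGaussianSequence (P.map f) coordGaussian := by
  have hfm := measurable_of_tendsto_gaussianPartialSum hg.measurable hf
  have hcomp : ∀ j, coordGaussian j ∘ f = g j := fun j => funext (coordGaussian_of_tendsto hf j)
  refine ⟨measurable_coordGaussian, fun j => ?_, ?_⟩
  · rw [Measure.map_map (measurable_coordGaussian j) hfm, hcomp, hg.law]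
  · rw [iIndepFun_iff_measure_inter_preimage_eq_mul]
    intro S sets hS
    have hpre : ∀ j, f ⁻¹' (coordGaussian j ⁻¹' sets j) = g j ⁻¹' sets j := fun j => by
      rw [← Set.preimage_comp, hcomp]
    rw [Measure.map_apply hfm
      (Finset.measurableSet_biInter S fun j hj => measurable_coordGaussian j (hS j hj))]
    simp only [Set.preimage_iInter, hpre]
    rw [hg.indep.measure_inter_preimage_eq_mul S hS]
    refine Finset.prod_congr rfl fun j hj => ?_
    rw [Measure.map_apply hfm (measurable_coordGaussian j (hS j hj)), hpre]

end

/-! ### The limiting density -/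

section

variable {μ : Measure 𝓢'(Plane, ℂ)} {p : ℝ}

theorem measurable_truncDensity (hp : -1 < p) {χ : ℝ → ℝ} (hμ : IsGaussianSequence μ coordGaussian)
    (hχ : Continuous χ) (n : ℕ) : Measurable (truncDensity p χ n) := by
  rw [truncDensity_eq_gaussianDensity]
  exact hμ.measurable_gaussianDensity (by linarith) hχ n

/-- For all cutoffs simultaneously, the Gibbs density is an explicit function of the almost sure
limits of the renormalized mass and of the `L^{p+1}` norm. -/
theorem exists_isGibbsDensity [IsProbabilityMeasure μ] (hμ : IsGaussianSequence μ coordGaussian)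
    (hp1 : 1 < p) (hp3 : p < 3) :
    ∃ M V : 𝓢'(Plane, ℂ) → ℝ, ∀ χ : ℝ → ℝ, IsCutoff χ →
      IsGibbsDensity p χ μ fun u => χ (M u) * Real.exp (2 / (p + 1) * V u ^ (p + 1)) := by
  obtain ⟨M, V, hMV⟩ := hμ.exists_limits (q := p + 1) (by linarith) (by linarith)
  refine ⟨M, V, fun χ hχ r hr => ?_⟩
  refine memLp_and_tendsto_eLpNorm_of_moments
    (fun k => measurable_truncDensity (by linarith) hμ hχ.1 _) ?_ (fun r hr => ?_) hr
  · filter_upwards [hMV] with u hu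
    simpa only [truncDensity_eq_gaussianDensity] using hu χ hχ.1
  · obtain ⟨B, hB, h⟩ := hμ.exists_moment_gaussianDensity_le (q := p + 1) (by linarith)
      (by linarith) hχ.1 hχ.2.1 (r := r) (by linarith)
    exact ⟨B, hB, fun k => by simpa only [truncDensity_eq_gaussianDensity] using h (2 ^ k)⟩

theorem IsGibbsDensity.ae_eq {χ : ℝ → ℝ} {ρ ρ' : 𝓢'(Plane, ℂ) → ℝ}
    (h : IsGibbsDensity p χ μ ρ) (h' : IsGibbsDensity p χ μ ρ') : ρ =ᵐ[μ] ρ' := by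
  obtain ⟨h1, h2, h3⟩ := h 1 le_rfl
  obtain ⟨-, h2', h3'⟩ := h' 1 le_rfl
  have h0 : ENNReal.ofReal 1 ≠ 0 := by simp
  exact tendstoInMeasure_ae_unique
    (tendstoInMeasure_of_tendsto_eLpNorm h0 (fun k => (h1 k).1) h2.1 h3)
    (tendstoInMeasure_of_tendsto_eLpNorm h0 (fun k => (h1 k).1) h2'.1 h3')

theorem totalVariation_withDensityᵥ {α : Type*} [MeasurableSpace α] {μ : Measure α} {ρ : α → ℝ}
    (hρ : Integrable ρ μ) :
    SignedMeasure.totalVariation (μ.withDensityᵥ ρ) = μ.withDensity fun x => ‖ρ x‖ₑ := by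
  rw [SignedMeasure.totalVariation_eq_variation, Measure.variation_withDensityᵥ hρ]

theorem IsGibbsDensity.integrable {χ : ℝ → ℝ} {ρ : 𝓢'(Plane, ℂ) → ℝ}
    (h : IsGibbsDensity p χ μ ρ) : Integrable ρ μ := by
  have h2 := (h 1 le_rfl).2.1
  rwa [ENNReal.ofReal_one, memLp_one_iff_integrable] at h2

theorem IsGibbsDensity.tendsto_totalVariation {χ : ℝ → ℝ} {ρ : 𝓢'(Plane, ℂ) → ℝ}
    (h : IsGibbsDensity p χ μ ρ) :
    Tendsto (fun k : ℕ => SignedMeasure.totalVariation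
      (μ.withDensityᵥ (truncDensity p χ (2 ^ k)) - μ.withDensityᵥ ρ) Set.univ) atTop (𝓝 0) := by
  obtain ⟨h1, -, h3⟩ := h 1 le_rfl
  simp only [ENNReal.ofReal_one, memLp_one_iff_integrable, eLpNorm_one_eq_lintegral_enorm]
    at h1 h3
  refine h3.congr fun k => ?_
  rw [← withDensityᵥ_sub' (h1 k) h.integrable,
    totalVariation_withDensityᵥ (ρ := fun u => truncDensity p χ (2 ^ k) u - ρ u)
      ((h1 k).sub h.integrable), withDensity_apply _ MeasurableSet.univ,
    Measure.restrict_univ]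

/-- A trapezoidal cutoff: `1` on `[-(m+1), m+1]` and `0` outside `[-(m+2), m+2]`. -/
def trapezoid (m : ℕ) (z : ℝ) : ℝ := max 0 (min 1 ((m : ℝ) + 2 - |z|))

theorem trapezoid_nonneg (m : ℕ) (z : ℝ) : 0 ≤ trapezoid m z := le_max_left _ _

theorem trapezoid_eq_one {m : ℕ} {z : ℝ} (hz : |z| ≤ (m : ℝ) + 1) : trapezoid m z = 1 := by
  rw [trapezoid, min_eq_left (by linarith), max_eq_right zero_le_one]

theorem isCutoff_trapezoid (m : ℕ) : IsCutoff (trapezoid m) := by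
  refine ⟨by unfold trapezoid; fun_prop, ?_, ?_⟩
  · refine HasCompactSupport.intro (isCompact_closedBall (0 : ℝ) ((m : ℝ) + 2)) fun z hz => ?_
    rw [mem_closedBall_zero_iff, Real.norm_eq_abs, not_le] at hz
    exact max_eq_left ((min_le_right _ _).trans (by linarith))
  · filter_upwards [Metric.ball_mem_nhds (0 : ℝ) one_pos] with z hz
    rw [mem_ball_zero_iff, Real.norm_eq_abs] at hz
    have : (0 : ℝ) ≤ m := m.cast_nonneg
    exact trapezoid_eq_one (by linarith)

end

end RadialNLS

end

theorem proposition2p5 {Ω : Type*} [MeasurableSpace Ω]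
    (P : Measure Ω) [IsProbabilityMeasure P]
    (g : ℕ → Ω → ℂ)
    (hg_meas : ∀ k, Measurable (g k))
    (hg_law : ∀ k, P.map (g k) = RadialNLS.stdComplexGaussian)
    (hg_indep : iIndepFun g P)
    (f : Ω → 𝓢'(RadialNLS.Plane, ℂ))
    (hf : ∀ ω, Tendsto (fun n => RadialNLS.gaussianPartialSum g n ω) atTop (𝓝 (f ω)))
    (μ : Measure 𝓢'(RadialNLS.Plane, ℂ)) (hμ : μ = P.map f)
    (p : ℝ) (hp1 : 1 < p) (hp3 : p < 3) :
    (∀ χ : ℝ → ℝ, RadialNLS.IsCutoff χ →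
      ∃ ρ : 𝓢'(RadialNLS.Plane, ℂ) → ℝ,
        -- convergence in every `L^r(μ)`, `1 ≤ r < ∞`
        RadialNLS.IsGibbsDensity p χ μ ρ ∧
        -- `dν = ρ dμ` is finite and absolutely continuous with respect to `μ`
        Integrable ρ μ ∧
        SignedMeasure.totalVariation (μ.withDensityᵥ ρ) ≪ μ ∧
        -- the total variation of `ν_{2^k} - ν` tends to zero
        Tendsto (fun k : ℕ =>
          SignedMeasure.totalVariation
            (μ.withDensityᵥ (RadialNLS.truncDensity p χ (2 ^ k)) - μ.withDensityᵥ ρ)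
            Set.univ) atTop (𝓝 0) ∧
        -- for a nonnegative cutoff, `ν` is a nonnegative measure
        ((∀ z, 0 ≤ χ z) →
          0 ≤ᵐ[μ] ρ ∧
          ∃ ν : Measure 𝓢'(RadialNLS.Plane, ℂ), ∃ _ : IsFiniteMeasure ν,
            ν = μ.withDensity (fun u => ENNReal.ofReal (ρ u)) ∧ ν ≪ μ ∧
            ν.toSignedMeasure = μ.withDensityᵥ ρ)) ∧
    -- countably many cutoffs whose limit densities have supports covering almost everything
    (∃ χ : ℕ → ℝ → ℝ, (∀ m, RadialNLS.IsCutoff (χ m) ∧ ∀ z, 0 ≤ χ m z) ∧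
      ∀ ρ : ℕ → 𝓢'(RadialNLS.Plane, ℂ) → ℝ,
        (∀ m, RadialNLS.IsGibbsDensity p (χ m) μ (ρ m)) →
        μ (⋃ m, Function.support (ρ m))ᶜ = 0) := by
  have hg : RadialNLS.IsGaussianSequence P g := ⟨hg_meas, hg_law, hg_indep⟩
  have hG : RadialNLS.IsGaussianSequence μ RadialNLS.coordGaussian := by
    rw [hμ]
    exact hg.map_coordGaussian hf
  have : IsProbabilityMeasure μ := by
    rw [hμ]
    exact Measure.isProbabilityMeasure_map
      (RadialNLS.measurable_of_tendsto_gaussianPartialSum hg_meas hf).aemeasurable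
  obtain ⟨M, V, hMV⟩ := RadialNLS.exists_isGibbsDensity hG hp1 hp3
  refine ⟨fun χ hχ => ?_, RadialNLS.trapezoid,
    fun m => ⟨RadialNLS.isCutoff_trapezoid m, RadialNLS.trapezoid_nonneg m⟩, fun ρ hρ => ?_⟩
  · have hρ := hMV χ hχ
    set ρ : 𝓢'(RadialNLS.Plane, ℂ) → ℝ :=
      fun u => χ (M u) * Real.exp (2 / (p + 1) * V u ^ (p + 1)) with hρdef
    have hint := hρ.integrable
    refine ⟨ρ, hρ, hint, ?_, hρ.tendsto_totalVariation, fun hχ0 => ?_⟩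
    · rw [RadialNLS.totalVariation_withDensityᵥ hint]
      exact withDensity_absolutelyContinuous _ _
    · have hρ0 : ∀ u, 0 ≤ ρ u := fun u => mul_nonneg (hχ0 _) (Real.exp_pos _).le
      refine ⟨ae_of_all _ hρ0, _, isFiniteMeasure_withDensity_ofReal hint.2, rfl,
        withDensity_absolutelyContinuous _ _, ?_⟩
      have h := withDensityᵥ_toReal hint.1.aemeasurable.ennreal_ofReal
        (hasFiniteIntegral_iff_ofReal (ae_of_all _ hρ0) |>.1 hint.2).ne
      simp only [ENNReal.toReal_ofReal (hρ0 _)] at h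
      exact h.symm
  · have h := ae_all_iff.2 fun m =>
      (hρ m).ae_eq (hMV (RadialNLS.trapezoid m) (RadialNLS.isCutoff_trapezoid m))
    rw [← mem_ae_iff]
    filter_upwards [h] with u hu
    obtain ⟨m, hm⟩ := exists_nat_ge |M u|
    refine Set.mem_iUnion.2 ⟨m, ?_⟩
    rw [Function.mem_support, hu m, RadialNLS.trapezoid_eq_one (by linarith), one_mul]
    exact (Real.exp_pos _).ne'
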